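/- Let $X$ be a finite set and let $Y$ be a finite abelian group, $N=|Y|$. A quantum algorithm making $q$ queries to a function $f:X\to Y$ works on a finite-dimensional register with basis states $|x,u,z\rangle$ ($x\in X$, $u\in Y$, $z$ in a finite set $Z$). It starts in a fixed unit vector, then performs $q$ rounds, each consisting of one application of the query unitary $|x,u,z\rangle\mapsto|x,u+f(x),z\rangle$ followed by an arbitrary unitary that does not depend on $f$, and finally measures in the computational basis and computes its output from the outcome. A $3$-collision of $f$ is a set of three distinct elements of $X$ on which $f$ is constant. Theorem. For every constant $p>0$ there are $c>0$ and $N_0$, depending only on $p$, such that for all finite $X$, all finite abelian groups $Y$ with $|Y|=N\ge N_0$ and all integers $0\le j\le N^{1/8}$: every quantum algorithm which, given oracle access to a uniformly random function $f:X\to Y$, outputs $j$ distinct $3$-collisions of $f$ with probability at least $p$ (over $f$ and the measurement) makes at least $c\,j^{4/7}N^{3/7}$ queries. In other words, finding $j$ distinct $3$-collisions of a random function with range of size $N$ with constant probability needs $\Omega(j^{4/7}N^{3/7})$ quantum queries. -/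

import Mathlib

namespace QuantumQuery

/-- Pure states on the computational basis `|x, u, z⟩`: query register `X`, response register `Y`,
private workspace `Z`. -/
abbrev QState (X Y Z : Type*) [Fintype X] [Fintype Y] [Fintype Z] : Type _ :=
  EuclideanSpace ℂ (X × Y × Z)

/-- The permutation `(x, u, z) ↦ (x, u + f x, z)` of the basis labels. -/
def queryPerm {X Y : Type*} (Z : Type*) [AddCommGroup Y] (f : X → Y) :
    Equiv.Perm (X × Y × Z) where
  toFun b := (b.1, b.2.1 + f b.1, b.2.2)
  invFun b := (b.1, b.2.1 - f b.1, b.2.2)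
  left_inv b := by simp
  right_inv b := by simp

/-- The unitary of one oracle query: `|x, u, z⟩ ↦ |x, u + f x, z⟩`. -/
noncomputable def oracle {X Y : Type*} (Z : Type*) [Fintype X] [Fintype Y] [Fintype Z]
    [AddCommGroup Y] (f : X → Y) : QState X Y Z ≃ₗᵢ[ℂ] QState X Y Z :=
  LinearIsometryEquiv.piLpCongrLeft 2 ℂ ℂ (queryPerm Z f)

/-- A quantum algorithm that queries an unknown function `X → Y` and outputs a finite family of
finite subsets of `X`.  Nothing in it depends on the queried function, and the unitaries are
arbitrary.  Only the first `queries` members of `unitary` are ever applied. -/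
structure Algorithm (X Y Z : Type*) [Fintype X] [Fintype Y] [Fintype Z] where
  /-- the number of oracle queries -/
  queries : ℕ
  /-- the initial state -/
  init : QState X Y Z
  norm_init : ‖init‖ = 1
  /-- `unitary i` is applied right after the query number `i + 1` -/
  unitary : ℕ → (QState X Y Z ≃ₗᵢ[ℂ] QState X Y Z)
  /-- classical output, computed from the outcome of the final measurement -/
  output : X × Y × Z → Finset (Finset X)

namespace Algorithm

variable {X Y Z : Type*} [Fintype X] [Fintype Y] [Fintype Z] [AddCommGroup Y]

/-- The state after `i` rounds (oracle query, then unitary) when the oracle is `f`. -/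
noncomputable def state (A : Algorithm X Y Z) (f : X → Y) : ℕ → QState X Y Z
  | 0 => A.init
  | i + 1 => A.unitary i (oracle Z f (A.state f i))

/-- Probability that, with oracle `f`, measuring the final state in the computational basis
yields an output satisfying `R`. -/
noncomputable def outputProb (A : Algorithm X Y Z) (f : X → Y)
    (R : Finset (Finset X) → Prop) : ℝ :=
  open Classical in
  ∑ b : X × Y × Z, if R (A.output b) then ‖A.state f A.queries b‖ ^ 2 else 0

end Algorithm

/-- `S` is a `k`-collision of `f`: a set of `k` (distinct) inputs with a common image. -/
def IsMultiCollision {X Y : Type*} (k : ℕ) (f : X → Y) (S : Finset X) : Prop :=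
  S.card = k ∧ ∀ x ∈ S, ∀ x' ∈ S, f x = f x'

/-- The family `C` consists of exactly `j` distinct sets, each of them a `k`-collision of `f`. -/
def IsCollisionFamily {X Y : Type*} (k j : ℕ) (f : X → Y) (C : Finset (Finset X)) : Prop :=
  C.card = j ∧ ∀ S ∈ C, IsMultiCollision k f S

/-- Probability, over a uniformly random function `f : X → Y` and the final measurement, that
the algorithm with oracle `f` outputs `j` distinct `k`-collisions of `f`. -/
noncomputable def successProb {X Y Z : Type*} [Fintype X] [DecidableEq X] [Fintype Y] [Fintype Z]
    [AddCommGroup Y] (A : Algorithm X Y Z) (k j : ℕ) : ℝ :=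
  (∑ f : X → Y, A.outputProb f (IsCollisionFamily k j f)) / (Fintype.card (X → Y) : ℝ)

end QuantumQuery

/-! The proof is a compressed-oracle argument. The random function is purified, and its queries are
conjugated so that they act on superpositions of databases `X → Option Y`, initially empty; a query
changes only the entry at its input. `decompress_cstate` recovers the true algorithm states, and
`successProb_le` shows that, up to an error O(j²/N), outputting j collisions requires weight on
databases that already record them.

Progress is measured by `excess k`, the total multiplicity of values beyond k. A query raises it
only by writing a value that already occurs k times elsewhere. If at most t values do, the amplitude
moved is at most 3√(t/N), by `sum_norm_fiberQuery_sq_le` and `ampl_restrict_excess_cquery_le`. For k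
≥ 1 the number of such values is at most the excess over k - 1, so each level controls the next:
starting from `excess 0` ≤ q, thresholds evolve as t ↦ q√(t/N) up to constants. For q of order
j^(4/7) N^(3/7) this gives j^(6/7) N^(1/7) at level 1 and j at level 2.

One value occurring c times yields about c³ triples, so `excess 2` alone does not bound the number
of collisions. `choose_three_le` charges the surplus to the cube of `excess 4`, which therefore has
to stay below order j^(1/3); two more levels of the recursion give this when j ≤ N^(1/8).

A threshold t fails with amplitude δ^t, and this error is multiplied by q at every later level.
Intermediate thresholds are therefore at least N^(1/16), even for bounded j, while the final ones
only need failure amplitude δ. -/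

namespace QuantumQuery

/-! ### Euclidean norms of amplitude families. -/

section L2

variable {ι : Type*} [Fintype ι]

/-- The Euclidean norm of a finite family of amplitudes. -/
noncomputable def l2norm (g : ι → ℂ) : ℝ := ‖(WithLp.toLp 2 g : EuclideanSpace ℂ ι)‖

theorem l2norm_sq (g : ι → ℂ) : l2norm g ^ 2 = ∑ i, ‖g i‖ ^ 2 := by
  simp [l2norm, EuclideanSpace.norm_sq_eq]

theorem l2norm_nonneg (g : ι → ℂ) : 0 ≤ l2norm g := norm_nonneg _

theorem l2norm_add_le (g h : ι → ℂ) : l2norm (g + h) ≤ l2norm g + l2norm h := by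
  simpa [l2norm] using norm_add_le (WithLp.toLp 2 g : EuclideanSpace ℂ ι) (WithLp.toLp 2 h)

theorem l2norm_le_mul_of_sum_le {κ : Type*} [Fintype κ] {g : ι → ℂ} {h : κ → ℂ} {c : ℝ}
    (hc : 0 ≤ c) (H : ∑ i, ‖g i‖ ^ 2 ≤ c ^ 2 * ∑ i, ‖h i‖ ^ 2) :
    l2norm g ≤ c * l2norm h := by
  apply le_of_sq_le_sq _ (mul_nonneg hc (l2norm_nonneg h))
  rw [mul_pow, l2norm_sq, l2norm_sq]
  exact H

theorem l2norm_le_of_sum_le {κ : Type*} [Fintype κ] {g : ι → ℂ} {h : κ → ℂ}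
    (H : ∑ i, ‖g i‖ ^ 2 ≤ ∑ i, ‖h i‖ ^ 2) : l2norm g ≤ l2norm h := by
  simpa using l2norm_le_mul_of_sum_le (g := g) (h := h) zero_le_one (by simpa using H)

end L2

/-! ### The compression reflection on a single database entry. -/

section Site

variable {Y : Type*} [Fintype Y]

/-- The coordinates of the vector `|uniform⟩ - |none⟩` on the basis `Option Y`. -/
noncomputable def siteWeight : Option Y → ℝ
  | none => -1
  | some _ => (√(Fintype.card Y))⁻¹

theorem sum_siteWeight_sq [Nonempty Y] : ∑ d : Option Y, siteWeight d ^ 2 = 2 := by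
  have h : (0 : ℝ) < Fintype.card Y := by exact_mod_cast Fintype.card_pos
  rw [Fintype.sum_option]
  simp only [siteWeight, Finset.sum_const, Finset.card_univ, nsmul_eq_mul, inv_pow,
    Real.sq_sqrt h.le]
  field_simp
  norm_num

/-- The component of `φ` along `|uniform⟩ - |none⟩`. -/
noncomputable def siteOverlap (φ : Option Y → ℂ) : ℂ := ∑ d, (siteWeight d : ℂ) * φ d

/-- The unitary of `ℂ ^ Option Y` exchanging `|uniform⟩` and `|none⟩`. -/
noncomputable def reflect (φ : Option Y → ℂ) (d : Option Y) : ℂ :=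
  φ d - siteWeight d * siteOverlap φ

theorem siteOverlap_reflect [Nonempty Y] (φ : Option Y → ℂ) :
    siteOverlap (reflect φ) = -siteOverlap φ := by
  have h : ∑ d : Option Y, (siteWeight d : ℂ) * siteWeight d = 2 := by
    have := sum_siteWeight_sq (Y := Y)
    simp only [sq] at this
    exact_mod_cast this
  calc siteOverlap (reflect φ)
      = ∑ d, ((siteWeight d : ℂ) * φ d - siteWeight d * siteWeight d * siteOverlap φ) := by
        simp only [siteOverlap, reflect]
        exact Finset.sum_congr rfl fun d _ => by ring
    _ = siteOverlap φ - 2 * siteOverlap φ := by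
        rw [Finset.sum_sub_distrib, ← Finset.sum_mul, h]; rfl
    _ = _ := by ring

theorem reflect_reflect [Nonempty Y] (φ : Option Y → ℂ) : reflect (reflect φ) = φ := by
  funext d
  rw [reflect, siteOverlap_reflect, reflect]
  ring

theorem norm_siteOverlap_sq_le [Nonempty Y] (φ : Option Y → ℂ) :
    ‖siteOverlap φ‖ ^ 2 ≤ 2 * ∑ d, ‖φ d‖ ^ 2 := by
  have h1 : ‖siteOverlap φ‖ ≤ ∑ d, |siteWeight d| * ‖φ d‖ := by
    refine (norm_sum_le _ _).trans_eq (Finset.sum_congr rfl fun d _ => ?_)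
    simp
  calc ‖siteOverlap φ‖ ^ 2 ≤ (∑ d, |siteWeight d| * ‖φ d‖) ^ 2 := by gcongr
    _ ≤ (∑ d, |siteWeight d| ^ 2) * ∑ d, ‖φ d‖ ^ 2 := Finset.sum_mul_sq_le_sq_mul_sq _ _ _
    _ = _ := by simp only [sq_abs]; rw [sum_siteWeight_sq]

theorem sum_norm_reflect_sq [Nonempty Y] (φ : Option Y → ℂ) :
    ∑ d, ‖reflect φ d‖ ^ 2 = ∑ d, ‖φ d‖ ^ 2 := by
  have key : ∀ d, ‖reflect φ d‖ ^ 2 = ‖φ d‖ ^ 2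
      - 2 * ((starRingEnd ℂ) (siteOverlap φ) * (siteWeight d * φ d)).re
      + siteWeight d ^ 2 * ‖siteOverlap φ‖ ^ 2 := by
    intro d
    simp only [← Complex.normSq_eq_norm_sq, reflect, Complex.normSq_apply, Complex.sub_re,
      Complex.sub_im, Complex.mul_re, Complex.mul_im, Complex.conj_re, Complex.conj_im,
      Complex.ofReal_re, Complex.ofReal_im]
    ring
  have h2 : ∑ d, ((starRingEnd ℂ) (siteOverlap φ) * (siteWeight d * φ d)).re
      = ‖siteOverlap φ‖ ^ 2 := by
    rw [← Complex.re_sum, ← Finset.mul_sum]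
    change ((starRingEnd ℂ) (siteOverlap φ) * siteOverlap φ).re = _
    rw [mul_comm, Complex.mul_conj, Complex.ofReal_re, Complex.normSq_eq_norm_sq]
  simp only [key]
  rw [Finset.sum_add_distrib, Finset.sum_sub_distrib, ← Finset.mul_sum, h2, ← Finset.sum_mul,
    sum_siteWeight_sq]
  ring

theorem norm_siteWeight_some_sq (y : Y) :
    ‖((siteWeight (some y) : ℝ) : ℂ)‖ ^ 2 = (Fintype.card Y : ℝ)⁻¹ := by
  simp [siteWeight]

theorem reflect_add (φ ψ : Option Y → ℂ) : reflect (φ + ψ) = reflect φ + reflect ψ := by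
  funext d
  simp only [reflect, siteOverlap, Pi.add_apply, mul_add, Finset.sum_add_distrib]
  ring

theorem reflect_zero : reflect (0 : Option Y → ℂ) = 0 := by
  funext d
  simp [reflect, siteOverlap]

/-- Weight moved by `reflect` from the complement of a set of values into that set. -/
theorem sum_norm_reflect_sq_le [Nonempty Y] (H : Finset Y) (φ : Option Y → ℂ)
    (hφ : ∀ y ∈ H, φ (some y) = 0) :
    ∑ y ∈ H, ‖reflect φ (some y)‖ ^ 2
      ≤ 2 * (H.card : ℝ) / Fintype.card Y * ∑ d, ‖φ d‖ ^ 2 := by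
  have h : ∀ y ∈ H, ‖reflect φ (some y)‖ ^ 2
      ≤ (Fintype.card Y : ℝ)⁻¹ * (2 * ∑ d, ‖φ d‖ ^ 2) := by
    intro y hy
    rw [reflect, hφ y hy, zero_sub, norm_neg, norm_mul, mul_pow, norm_siteWeight_some_sq]
    gcongr
    exact norm_siteOverlap_sq_le φ
  refine (Finset.sum_le_sum h).trans_eq ?_
  rw [Finset.sum_const, nsmul_eq_mul]
  ring

end Site

/-! ### A compressed query on the response register and one entry. -/

section Fiber

variable {Y : Type*} [Fintype Y] [AddCommGroup Y]

/-- The query unitary on the response register, controlled by a database entry. -/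
def shift (φ : Y → Option Y → ℂ) (u : Y) (d : Option Y) : ℂ := φ (u - d.getD 0) d

/-- The compressed query, on the response register and one database entry. -/
noncomputable def fiberQuery (φ : Y → Option Y → ℂ) (u : Y) : Option Y → ℂ :=
  reflect (shift (fun v => reflect (φ v)) u)

theorem sum_norm_shift_sq (φ : Y → Option Y → ℂ) :
    ∑ u, ∑ d, ‖shift φ u d‖ ^ 2 = ∑ u, ∑ d, ‖φ u d‖ ^ 2 := by
  rw [Finset.sum_comm]
  refine Eq.trans ?_ Finset.sum_comm
  refine Finset.sum_congr rfl fun d _ => ?_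
  exact (Equiv.subRight (d.getD 0)).sum_comp (fun u => ‖φ u d‖ ^ 2)

theorem sum_norm_fiberQuery_sq (φ : Y → Option Y → ℂ) :
    ∑ u, ∑ d, ‖fiberQuery φ u d‖ ^ 2 = ∑ u, ∑ d, ‖φ u d‖ ^ 2 := by
  simp only [fiberQuery, sum_norm_reflect_sq, sum_norm_shift_sq]

theorem fiberQuery_add (φ ψ : Y → Option Y → ℂ) :
    fiberQuery (φ + ψ) = fiberQuery φ + fiberQuery ψ := by
  funext u
  simp only [fiberQuery, Pi.add_apply, reflect_add]
  rw [← reflect_add]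
  rfl

theorem fiberQuery_zero : fiberQuery (0 : Y → Option Y → ℂ) = 0 := by
  funext u
  simp only [fiberQuery, Pi.zero_apply, reflect_zero]
  exact reflect_zero

/-- Weight moved by a compressed query from the complement of a set of values into that set. -/
theorem sum_norm_fiberQuery_sq_le (H : Finset Y) (φ : Y → Option Y → ℂ)
    (hφ : ∀ u, ∀ y ∈ H, φ u (some y) = 0) :
    ∑ u, ∑ y ∈ H, ‖fiberQuery φ u (some y)‖ ^ 2
      ≤ 8 * (H.card : ℝ) / Fintype.card Y * ∑ u, ∑ d, ‖φ u d‖ ^ 2 := by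
  set ψ := shift (fun v => reflect (φ v)) with hψ
  set n : ℝ := (Fintype.card Y : ℝ)⁻¹ with hn
  have hn0 : 0 ≤ n := by positivity
  set T := ∑ u, ∑ d, ‖φ u d‖ ^ 2 with hT
  have hψT : ∑ u, ∑ d, ‖ψ u d‖ ^ 2 = T := by
    rw [hψ, sum_norm_shift_sq]; simp only [sum_norm_reflect_sq, hT]
  have hpt : ∀ u, ∀ y ∈ H, ‖fiberQuery φ u (some y)‖ ^ 2
      ≤ 2 * (n * ‖siteOverlap (φ (u - y))‖ ^ 2 + n * ‖siteOverlap (ψ u)‖ ^ 2) := by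
    intro u y hy
    -- Amplitude reaches `some y` only through the two reflections, each with weight of modulus
    -- N^(-1/2): the first is read at `u - y` because of the shift, the second at `u`.
    have h1 : fiberQuery φ u (some y) = -((siteWeight (some y) : ℝ) : ℂ) *
        siteOverlap (φ (u - y)) + -((siteWeight (some y) : ℝ) : ℂ) * siteOverlap (ψ u) := by
      have : ψ u (some y) = φ (u - y) (some y) - siteWeight (some y) * siteOverlap (φ (u - y)) :=
        rfl
      rw [fiberQuery, ← hψ, reflect, this, hφ _ y hy]
      ring
    rw [h1, hn, ← norm_siteWeight_some_sq y, ← mul_pow, ← mul_pow, ← norm_mul, ← norm_mul]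
    refine (pow_le_pow_left₀ (norm_nonneg _) (norm_add_le _ _) 2).trans ?_
    simp only [norm_mul, norm_neg]
    exact add_sq_le
  calc ∑ u, ∑ y ∈ H, ‖fiberQuery φ u (some y)‖ ^ 2
      ≤ ∑ u, ∑ y ∈ H, 2 * (n * ‖siteOverlap (φ (u - y))‖ ^ 2 + n * ‖siteOverlap (ψ u)‖ ^ 2) :=
        Finset.sum_le_sum fun u _ => Finset.sum_le_sum (hpt u)
    _ = 2 * n * (∑ y ∈ H, ∑ u, ‖siteOverlap (φ (u - y))‖ ^ 2)
        + 2 * n * (H.card * ∑ u, ‖siteOverlap (ψ u)‖ ^ 2) := by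
        rw [Finset.sum_comm]
        simp only [mul_add, Finset.sum_add_distrib, Finset.mul_sum, Finset.sum_const,
          nsmul_eq_mul]
        congr 1
        · exact Finset.sum_congr rfl fun _ _ => Finset.sum_congr rfl fun _ _ => by ring
        · exact Finset.sum_congr rfl fun _ _ => by ring
    _ = 2 * n * (H.card * ∑ u, ‖siteOverlap (φ u)‖ ^ 2)
        + 2 * n * (H.card * ∑ u, ‖siteOverlap (ψ u)‖ ^ 2) := by
        congr 2
        rw [← nsmul_eq_mul, ← Finset.sum_const]
        exact Finset.sum_congr rfl fun y _ =>
          (Equiv.subRight y).sum_comp (fun u => ‖siteOverlap (φ u)‖ ^ 2)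
    _ ≤ 2 * n * (H.card * (2 * T)) + 2 * n * (H.card * (2 * T)) := by
        gcongr
        · rw [hT, Finset.mul_sum]
          exact Finset.sum_le_sum fun u _ => norm_siteOverlap_sq_le _
        · rw [← hψT, Finset.mul_sum]
          exact Finset.sum_le_sum fun u _ => norm_siteOverlap_sq_le _
    _ = _ := by rw [hn]; ring

end Fiber

end QuantumQuery

namespace QuantumQuery

open Function
open scoped Classical

/-! ### Compression and decompression of whole databases. -/

section Database

set_option linter.unusedSectionVars false

variable {X Y : Type*} [Fintype X] [Fintype Y]

/-- Swapping the entry at `x` with the extra coordinate `d` is an involution of the index set. This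
reduces estimates on databases to estimates on the fibres where only one entry varies. -/
theorem sum_sum_update {M : Type*} [AddCommMonoid M] {β : Type*} [Fintype β] [DecidableEq X]
    (x : X) (g : (X → β) → M) :
    ∑ D : X → β, ∑ d, g (update D x d) = Fintype.card β • ∑ D, g D := by
  have hinv : Involutive fun p : (X → β) × β => (update p.1 x p.2, p.1 x) := fun p =>
    Prod.ext (by simp only [update_idem, update_eq_self]) (by simp only [update_self])
  have h := Equiv.sum_comp hinv.toPerm fun p : (X → β) × β => g p.1
  rw [Fintype.sum_prod_type, Fintype.sum_prod_type_right] at h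
  exact h.trans ((Finset.sum_const (∑ D, g D)).trans (by rw [Finset.card_univ]))

variable [DecidableEq X]

theorem sum_le_sum_of_sum_update_le {β : Type*} [Fintype β] [Nonempty β] (x : X)
    {g h : (X → β) → ℝ}
    (H : ∀ D, ∑ d, g (update D x d) ≤ ∑ d, h (update D x d)) : ∑ D, g D ≤ ∑ D, h D := by
  have := Finset.sum_le_sum fun D (_ : D ∈ Finset.univ) => H D
  rw [sum_sum_update, sum_sum_update, nsmul_eq_mul, nsmul_eq_mul] at this
  exact le_of_mul_le_mul_left this (by exact_mod_cast Fintype.card_pos)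

/-- `reflect` acting on the entry at `x` of a database. -/
noncomputable def siteF (x : X) (g : (X → Option Y) → ℂ) (D : X → Option Y) : ℂ :=
  reflect (fun d => g (update D x d)) (D x)

theorem siteF_update (x : X) (g : (X → Option Y) → ℂ) (D : X → Option Y) (d : Option Y) :
    siteF x g (update D x d) = reflect (fun d => g (update D x d)) d := by
  simp [siteF]

theorem siteF_add (x : X) (g h : (X → Option Y) → ℂ) :
    siteF x (g + h) = siteF x g + siteF x h := by
  funext D
  exact congrFun (reflect_add _ _) _

theorem siteF_siteF [Nonempty Y] (x : X) (g : (X → Option Y) → ℂ) :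
    siteF x (siteF x g) = g := by
  funext D
  rw [siteF]
  simp only [siteF_update, reflect_reflect, update_eq_self]

/-- The expanded form is symmetric in the two sites, which is what `siteF_comm` needs. -/
theorem siteF_siteF_apply {x x' : X} (h : x ≠ x') (g : (X → Option Y) → ℂ)
    (D : X → Option Y) :
    siteF x (siteF x' g) D = g D - (siteWeight (D x) * ∑ d, siteWeight d * g (update D x d)
        + siteWeight (D x') * ∑ d, siteWeight d * g (update D x' d))
      + siteWeight (D x) * siteWeight (D x') *
        ∑ d, ∑ d', siteWeight d * siteWeight d' * g (update (update D x d) x' d') := by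
  simp only [siteF, reflect, siteOverlap, update_eq_self, update_of_ne h.symm, mul_sub,
    Finset.sum_sub_distrib]
  have : ∑ d, (siteWeight d : ℂ) * (siteWeight (D x') *
        ∑ d', siteWeight d' * g (update (update D x d) x' d'))
      = siteWeight (D x') *
        ∑ d, ∑ d', siteWeight d * siteWeight d' * g (update (update D x d) x' d') := by
    simp only [Finset.mul_sum]
    exact Finset.sum_congr rfl fun _ _ => Finset.sum_congr rfl fun _ _ => by ring
  have hu : ∀ d, update (update D x d) x' (D x') = update D x d := fun d => by
    rw [update_comm h, update_eq_self]
  simp only [this, hu]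
  ring

theorem siteF_comm {x x' : X} (h : x ≠ x') (g : (X → Option Y) → ℂ) :
    siteF x (siteF x' g) = siteF x' (siteF x g) := by
  funext D
  rw [siteF_siteF_apply h, siteF_siteF_apply h.symm, Finset.sum_comm]
  simp only [update_comm h]
  rw [add_comm (siteWeight (D x) * ∑ d, siteWeight d * g (update D x d) : ℂ),
    mul_comm (siteWeight (D x) : ℂ) (siteWeight (D x'))]
  congr 2
  exact Finset.sum_congr rfl fun _ _ => Finset.sum_congr rfl fun _ _ => by ring

theorem sum_norm_siteF_sq_le [Nonempty Y] (x : X) (g : (X → Option Y) → ℂ) :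
    ∑ D, ‖siteF x g D‖ ^ 2 ≤ ∑ D, ‖g D‖ ^ 2 := by
  refine sum_le_sum_of_sum_update_le x fun D => le_of_eq ?_
  simp only [siteF_update]
  exact sum_norm_reflect_sq fun d => g (update D x d)

/-- Decompression of the database entries in a list. -/
noncomputable def decompress (l : List X) (g : (X → Option Y) → ℂ) : (X → Option Y) → ℂ :=
  l.foldr siteF g

@[simp] theorem decompress_cons (x : X) (l : List X) (g : (X → Option Y) → ℂ) :
    decompress (x :: l) g = siteF x (decompress l g) := rfl

@[simp] theorem decompress_nil (g : (X → Option Y) → ℂ) : decompress [] g = g := rfl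

theorem decompress_siteF {x : X} {l : List X} (hx : x ∉ l) (g : (X → Option Y) → ℂ) :
    decompress l (siteF x g) = siteF x (decompress l g) := by
  induction l with
  | nil => rfl
  | cons a l ih =>
    simp only [List.mem_cons, not_or] at hx
    rw [decompress_cons, decompress_cons, ih hx.2, siteF_comm hx.1]

theorem decompress_perm {l l' : List X} (h : l.Perm l') (g : (X → Option Y) → ℂ) :
    decompress l g = decompress l' g := by
  induction h with
  | nil => rfl
  | cons x _ ih => rw [decompress_cons, decompress_cons, ih]
  | swap x y l =>
    simp only [decompress_cons]
    rcases eq_or_ne x y with rfl | hxy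
    · rfl
    · rw [siteF_comm hxy]
  | trans _ _ ih ih' => rw [ih, ih']

/-- Decompressing other entries never changes the entry at `x`, so it commutes with any control on
that entry. -/
theorem decompress_controlled {x : X} {l : List X} (hx : x ∉ l)
    (g : Option Y → (X → Option Y) → ℂ) :
    decompress l (fun D => g (D x) D) = fun D => decompress l (g (D x)) D := by
  induction l with
  | nil => rfl
  | cons a l ih =>
    simp only [List.mem_cons, not_or] at hx
    rw [decompress_cons, ih hx.2]
    funext D
    simp only [decompress_cons, siteF, update_of_ne hx.1]

/-- The empty database decompresses to the uniform superposition. -/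
theorem decompress_empty [Nonempty Y] {l : List X} (hl : l.Nodup) (D : X → Option Y) :
    decompress l (fun D => if D = fun _ => none then 1 else 0) D
      = ∏ x, (if x ∈ l then (if D x = none then 0 else ((√(Fintype.card Y))⁻¹ : ℂ))
          else if D x = none then 1 else 0) := by
  induction l generalizing D with
  | nil =>
    simp only [decompress_nil, List.not_mem_nil, if_false]
    rw [Finset.prod_boole]
    simp [funext_iff]
  | cons a l ih =>
    obtain ⟨ha, hl⟩ := List.nodup_cons.1 hl
    set R := ∏ x ∈ Finset.univ.erase a,
      (if x ∈ l then (if D x = none then 0 else ((√(Fintype.card Y))⁻¹ : ℂ))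
          else if D x = none then 1 else 0) with hR
    -- The entry at `a` is still `none` and factors out; the reflection then turns it into the
    -- uniform vector.
    have h1 : ∀ d, decompress l (fun D => if D = fun _ => none then (1 : ℂ) else 0)
        (update D a d) = (if d = none then 1 else 0) * R := by
      intro d
      rw [ih hl, ← Finset.mul_prod_erase _ _ (Finset.mem_univ a), if_neg ha, update_self, hR]
      congr 1
      refine Finset.prod_congr rfl fun x hx => ?_
      rw [update_of_ne (Finset.ne_of_mem_erase hx)]
    rw [decompress_cons, siteF]
    simp only [h1]
    rw [← Finset.mul_prod_erase _ _ (Finset.mem_univ a), if_pos List.mem_cons_self]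
    have h2 : ∏ x ∈ Finset.univ.erase a,
      (if x ∈ a :: l then (if D x = none then 0 else ((√(Fintype.card Y))⁻¹ : ℂ))
          else if D x = none then 1 else 0) = R := by
      refine Finset.prod_congr rfl fun x hx => ?_
      simp [Finset.ne_of_mem_erase hx]
    rw [h2]
    simp only [reflect, siteOverlap, Fintype.sum_option]
    cases D a <;> simp [siteWeight]

/-- Hybrid step: decompressing one entry creates little weight on a property that pins that
entry. -/
theorem l2norm_siteF_le [Nonempty Y] (x : X) (R : (X → Option Y) → Prop)
    (hnone : ∀ D, R D → D x ≠ none)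
    (huniq : ∀ D y y', R (update D x (some y)) → R (update D x (some y')) → y = y')
    (g : (X → Option Y) → ℂ) :
    l2norm (fun D => if R D then siteF x g D else 0)
      ≤ l2norm (fun D => if R D then g D else 0)
        + √(2 / Fintype.card Y) * l2norm g := by
  set g₁ : (X → Option Y) → ℂ := fun D => if R D then g D else 0 with hg₁
  set g₂ : (X → Option Y) → ℂ := fun D => if R D then 0 else g D with hg₂
  have hg : g = g₁ + g₂ := by
    funext D; by_cases h : R D <;> simp [hg₁, hg₂, h]
  have hsplit : (fun D => if R D then siteF x g D else 0)
      = (fun D => if R D then siteF x g₁ D else 0) + fun D => if R D then siteF x g₂ D else 0 := by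
    funext D
    rw [hg, siteF_add]
    by_cases h : R D <;> simp [h]
  rw [hsplit]
  refine (l2norm_add_le _ _).trans (add_le_add ?_ ?_)
  · refine l2norm_le_of_sum_le (le_trans (Finset.sum_le_sum fun D _ => ?_)
      (sum_norm_siteF_sq_le x g₁))
    split_ifs
    · exact le_rfl
    · simp
  · refine l2norm_le_mul_of_sum_le (Real.sqrt_nonneg _) ?_
    rw [Real.sq_sqrt (by positivity), Finset.mul_sum]
    refine sum_le_sum_of_sum_update_le x fun D => ?_
    -- On each fibre at most one value satisfies `R`, so the single-site bound applies with at most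
    -- one target value.
    set H : Finset Y := Finset.univ.filter fun y => R (update D x (some y)) with hH
    have hHcard : H.card ≤ 1 := Finset.card_le_one.2 fun y hy y' hy' =>
      huniq D y y' (by simpa [hH] using hy) (by simpa [hH] using hy')
    have hn : ¬ R (update D x none) := fun h => hnone _ h (by simp)
    rw [Fintype.sum_option, if_neg hn]
    simp only [norm_zero, ne_eq, OfNat.ofNat_ne_zero, not_false_eq_true, zero_pow, zero_add]
    calc ∑ y, ‖if R (update D x (some y)) then siteF x g₂ (update D x (some y)) else 0‖ ^ 2
        = ∑ y ∈ H, ‖reflect (fun d => g₂ (update D x d)) (some y)‖ ^ 2 := by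
          rw [hH, Finset.sum_filter]
          refine Finset.sum_congr rfl fun y _ => ?_
          split_ifs
          · rw [siteF_update]
          · simp
      _ ≤ 2 * (H.card : ℝ) / Fintype.card Y * ∑ d, ‖g₂ (update D x d)‖ ^ 2 := by
          refine sum_norm_reflect_sq_le H _ fun y hy => ?_
          have : R (update D x (some y)) := by simpa [hH] using hy
          simp [hg₂, this]
      _ ≤ 2 * 1 / Fintype.card Y * ∑ d, ‖g (update D x d)‖ ^ 2 := by
          gcongr with d
          · exact_mod_cast hHcard
          · simp only [hg₂]; split_ifs <;> simp
      _ = _ := by rw [mul_one, Finset.mul_sum]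

theorem l2norm_siteF_of_forall_update [Nonempty Y] (x : X) (R : (X → Option Y) → Prop)
    (hR : ∀ D d, R (update D x d) ↔ R D) (g : (X → Option Y) → ℂ) :
    l2norm (fun D => if R D then siteF x g D else 0)
      ≤ l2norm (fun D => if R D then g D else 0) := by
  have : (fun D => if R D then siteF x g D else 0) = siteF x fun D => if R D then g D else 0 := by
    funext D
    by_cases h : R D
    · simp only [h, if_true, siteF, hR]
    · simp only [h, if_false, siteF, hR]
      exact (congrFun reflect_zero _).symm
  rw [this]
  exact l2norm_le_of_sum_le (sum_norm_siteF_sq_le _ _)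

theorem l2norm_decompress_le [Nonempty Y] (l : List X) (g : (X → Option Y) → ℂ) :
    l2norm (decompress l g) ≤ l2norm g := by
  induction l with
  | nil => exact le_rfl
  | cons x l ih => exact (l2norm_le_of_sum_le (sum_norm_siteF_sq_le _ _)).trans ih

/-- Decompressing the whole database creates little weight on a property that only depends on the
entries in `W` and pins each of them given the others. -/
theorem l2norm_restrict_decompress_le [Nonempty Y] (W : Finset X) (R : (X → Option Y) → Prop)
    (hnone : ∀ x ∈ W, ∀ D, R D → D x ≠ none)
    (huniq : ∀ x ∈ W, ∀ D y y', R (update D x (some y)) → R (update D x (some y')) → y = y')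
    (hR : ∀ x ∉ W, ∀ D d, R (update D x d) ↔ R D)
    {l : List X} (hl : l.Nodup) (g : (X → Option Y) → ℂ) :
    l2norm (fun D => if R D then decompress l g D else 0)
      ≤ l2norm (fun D => if R D then g D else 0)
        + W.card * √(2 / Fintype.card Y) * l2norm g := by
  have key : ∀ l : List X, l.Nodup → l2norm (fun D => if R D then decompress l g D else 0)
      ≤ l2norm (fun D => if R D then g D else 0)
        + (l.toFinset ∩ W).card * √(2 / Fintype.card Y) * l2norm g := by
    intro l hl
    induction l with
    | nil => simp
    | cons x l ih =>
      obtain ⟨hx, hl⟩ := List.nodup_cons.1 hl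
      specialize ih hl
      rw [decompress_cons, List.toFinset_cons]
      -- Entries in `W` cost one hybrid step each. For the others the reflection commutes with the
      -- projection to `R` and costs nothing.
      by_cases hW : x ∈ W
      · rw [Finset.insert_inter_of_mem hW, Finset.card_insert_of_notMem (by simp [hx])]
        have h1 := l2norm_siteF_le x R (hnone x hW) (huniq x hW) (decompress l g)
        have h2 := mul_le_mul_of_nonneg_left (l2norm_decompress_le l g)
          (Real.sqrt_nonneg (2 / Fintype.card Y))
        push_cast
        linarith
      · rw [Finset.insert_inter_of_notMem hW]
        exact (l2norm_siteF_of_forall_update x R (hR x hW) _).trans ih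
  refine (key l hl).trans ?_
  gcongr
  · exact l2norm_nonneg _
  · exact Finset.inter_subset_right

end Database

end QuantumQuery

namespace QuantumQuery

open Function
open scoped Classical

/-! ### Joint evolution of the algorithm and the compressed oracle. -/

section Evolution

set_option linter.unusedSectionVars false

variable {X Y Z : Type*} [Fintype X] [Fintype Y] [Fintype Z] [DecidableEq X]

/-- Joint states of the registers of an algorithm and of a compressed database. -/
abbrev CState (X Y Z : Type*) : Type _ := X × Y × Z → (X → Option Y) → ℂ

/-- The norm of a joint state. -/
noncomputable def ampl (Φ : CState X Y Z) : ℝ :=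
  l2norm fun p : (X × Y × Z) × (X → Option Y) => Φ p.1 p.2

theorem ampl_sq (Φ : CState X Y Z) : ampl Φ ^ 2 = ∑ b, ∑ D, ‖Φ b D‖ ^ 2 := by
  rw [ampl, l2norm_sq, Fintype.sum_prod_type]

theorem ampl_nonneg (Φ : CState X Y Z) : 0 ≤ ampl Φ := l2norm_nonneg _

@[simp] theorem ampl_zero : ampl (0 : CState X Y Z) = 0 := by
  simpa using ampl_sq (0 : CState X Y Z)

theorem ampl_add_le (Φ Ψ : CState X Y Z) : ampl (Φ + Ψ) ≤ ampl Φ + ampl Ψ :=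
  l2norm_add_le _ _

theorem ampl_le_mul {Φ Ψ : CState X Y Z} {c : ℝ} (hc : 0 ≤ c)
    (H : ∑ b, ∑ D, ‖Φ b D‖ ^ 2 ≤ c ^ 2 * ∑ b, ∑ D, ‖Ψ b D‖ ^ 2) : ampl Φ ≤ c * ampl Ψ := by
  apply le_of_sq_le_sq _ (mul_nonneg hc (ampl_nonneg Ψ))
  rwa [mul_pow, ampl_sq, ampl_sq]

theorem ampl_mono {Φ Ψ : CState X Y Z} (H : ∀ b D, ‖Φ b D‖ ≤ ‖Ψ b D‖) : ampl Φ ≤ ampl Ψ := by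
  have := ampl_le_mul (Φ := Φ) (Ψ := Ψ) zero_le_one (by
    rw [one_pow, one_mul]
    gcongr with b _ D
    exact H b D)
  simpa using this

/-- The projection to a set of databases. -/
noncomputable def restrict (P : (X → Option Y) → Prop) (Φ : CState X Y Z) : CState X Y Z :=
  fun b D => if P D then Φ b D else 0

theorem restrict_of_pos {P : (X → Option Y) → Prop} {D : X → Option Y} (h : P D)
    (Φ : CState X Y Z) (b : X × Y × Z) : restrict P Φ b D = Φ b D := if_pos h

theorem restrict_of_neg {P : (X → Option Y) → Prop} {D : X → Option Y} (h : ¬ P D)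
    (Φ : CState X Y Z) (b : X × Y × Z) : restrict P Φ b D = 0 := if_neg h

theorem norm_restrict_le (P : (X → Option Y) → Prop) (Φ : CState X Y Z) (b : X × Y × Z)
    (D : X → Option Y) : ‖restrict P Φ b D‖ ≤ ‖Φ b D‖ := by
  rw [restrict]
  split_ifs <;> simp

theorem ampl_restrict_le (P : (X → Option Y) → Prop) (Φ : CState X Y Z) :
    ampl (restrict P Φ) ≤ ampl Φ := by
  exact ampl_mono (norm_restrict_le P Φ)

theorem restrict_add (P : (X → Option Y) → Prop) (Φ Ψ : CState X Y Z) :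
    restrict P (Φ + Ψ) = restrict P Φ + restrict P Ψ := by
  funext b D
  by_cases h : P D <;> simp [restrict, h]

theorem restrict_add_restrict_not (P : (X → Option Y) → Prop) (Φ : CState X Y Z) :
    restrict P Φ + restrict (fun D => ¬ P D) Φ = Φ := by
  funext b D
  by_cases h : P D <;> simp [restrict, h]

/-- A unitary of the registers, acting on joint states. -/
noncomputable def liftU (U : QState X Y Z ≃ₗᵢ[ℂ] QState X Y Z) (Φ : CState X Y Z) :
    CState X Y Z :=
  fun b D => U (WithLp.toLp 2 fun b' => Φ b' D) b

theorem liftU_add (U : QState X Y Z ≃ₗᵢ[ℂ] QState X Y Z) (Φ Ψ : CState X Y Z) :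
    liftU U (Φ + Ψ) = liftU U Φ + liftU U Ψ := by
  funext b D
  have : (WithLp.toLp 2 fun b' => (Φ + Ψ) b' D : QState X Y Z)
    = WithLp.toLp 2 (fun b' => Φ b' D) + WithLp.toLp 2 (fun b' => Ψ b' D) := rfl
  simp only [liftU, this, map_add]
  rfl

theorem restrict_liftU (P : (X → Option Y) → Prop) (U : QState X Y Z ≃ₗᵢ[ℂ] QState X Y Z)
    (Φ : CState X Y Z) : restrict P (liftU U Φ) = liftU U (restrict P Φ) := by
  funext b D
  by_cases h : P D
  · simp [restrict, liftU, h]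
  · simp only [restrict, liftU, h, if_false]
    have : (WithLp.toLp 2 fun _ => 0 : QState X Y Z) = 0 := rfl
    rw [this, map_zero]
    rfl

theorem ampl_liftU (U : QState X Y Z ≃ₗᵢ[ℂ] QState X Y Z) (Φ : CState X Y Z) :
    ampl (liftU U Φ) = ampl Φ := by
  refine (sq_eq_sq₀ (ampl_nonneg _) (ampl_nonneg _)).1 ?_
  rw [ampl_sq, ampl_sq, Finset.sum_comm]
  refine Eq.trans ?_ Finset.sum_comm
  refine Finset.sum_congr rfl fun D _ => ?_
  have := U.norm_map (WithLp.toLp 2 fun b' => Φ b' D)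
  have h2 := congrArg (· ^ 2) this
  simpa only [EuclideanSpace.norm_sq_eq, liftU] using h2

/-- The two operators act on different tensor factors, and `U` is linear. -/
theorem decompress_liftU (l : List X) (U : QState X Y Z ≃ₗᵢ[ℂ] QState X Y Z)
    (Φ : CState X Y Z) :
    (fun b => decompress l (liftU U Φ b)) = liftU U fun b => decompress l (Φ b) := by
  induction l with
  | nil => rfl
  | cons x l ih =>
    have ih' : ∀ b, decompress l (liftU U Φ b) = liftU U (fun b => decompress l (Φ b)) b :=
      congrFun ih
    funext b D
    simp only [decompress_cons, ih']
    set Ψ := fun b => decompress l (Φ b) with hΨ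
    have hΨ' : ∀ b, decompress l (Φ b) = Ψ b := fun _ => rfl
    simp only [siteF, reflect, siteOverlap, liftU, hΨ']
    have : (WithLp.toLp 2 fun b' => Ψ b' (update D x (D x)) - siteWeight (D x) *
          ∑ d, siteWeight d * Ψ b' (update D x d) : QState X Y Z)
        = WithLp.toLp 2 (fun b' => Ψ b' (update D x (D x))) - (siteWeight (D x) : ℂ) •
          ∑ d, (siteWeight d : ℂ) • WithLp.toLp 2 fun b' => Ψ b' (update D x d) := by
      ext b'
      simp [mul_add]
    rw [this, map_sub, map_smul, map_sum]
    simp only [map_smul]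
    simp [mul_add]

variable [AddCommGroup Y]

/-- The compressed oracle query. -/
noncomputable def cquery (Φ : CState X Y Z) : CState X Y Z := fun b D =>
  fiberQuery (fun v d => Φ (b.1, v, b.2.2) (update D b.1 d)) b.2.1 (D b.1)

theorem cquery_update (Φ : CState X Y Z) (x : X) (u : Y) (z : Z) (D : X → Option Y)
    (d : Option Y) :
    cquery Φ (x, u, z) (update D x d)
      = fiberQuery (fun v d => Φ (x, v, z) (update D x d)) u d := by
  simp [cquery]

theorem cquery_add (Φ Ψ : CState X Y Z) : cquery (Φ + Ψ) = cquery Φ + cquery Ψ := by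
  funext b D
  exact congrFun (congrFun (fiberQuery_add _ _) _) _

/-- Sums over joint states may be compared fibre by fibre. -/
theorem sum_le_sum_of_fiber {g h : X × Y × Z → (X → Option Y) → ℝ}
    (H : ∀ x z D, ∑ u, ∑ d, g (x, u, z) (update D x d) ≤ ∑ u, ∑ d, h (x, u, z) (update D x d)) :
    ∑ b, ∑ D, g b D ≤ ∑ b, ∑ D, h b D := by
  have key : ∀ g : X × Y × Z → (X → Option Y) → ℝ,
      ∑ b, ∑ D, g b D = ∑ x, ∑ z, ∑ D, ∑ u, g (x, u, z) D := by
    intro g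
    rw [Fintype.sum_prod_type]
    refine Finset.sum_congr rfl fun x _ => ?_
    rw [Fintype.sum_prod_type_right]
    exact Finset.sum_congr rfl fun z _ => Finset.sum_comm
  rw [key, key]
  refine Finset.sum_le_sum fun x _ => Finset.sum_le_sum fun z _ => ?_
  refine sum_le_sum_of_sum_update_le x fun D => ?_
  exact Finset.sum_comm.trans_le ((H x z D).trans_eq Finset.sum_comm)

theorem ampl_cquery_le (Φ : CState X Y Z) : ampl (cquery Φ) ≤ ampl Φ := by
  have := ampl_le_mul (Φ := cquery Φ) (Ψ := Φ) zero_le_one (by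
    rw [one_pow, one_mul]
    refine sum_le_sum_of_fiber fun x z D => ?_
    simp only [cquery_update]
    exact (sum_norm_fiberQuery_sq fun v d => Φ (x, v, z) (update D x d)).le)
  simpa using this

/-- Decompression order is irrelevant, so site `x` can be taken next to the query. Its reflection
cancels the outer one of the compressed query; the remaining shift is controlled by the entry at `x`
and passes through the other sites. -/
theorem decompress_cquery (Φ : CState X Y Z) {l : List X} (hl : l.Nodup)
    (hmem : ∀ x, x ∈ l) (x : X) (u : Y) (z : Z) (D : X → Option Y) :
    decompress l (cquery Φ (x, u, z)) D
      = decompress l (Φ (x, u - (D x).getD 0, z)) D := by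
  obtain ⟨l', hp⟩ : ∃ l', l.Perm (x :: l') := ⟨_, List.perm_cons_erase (hmem x)⟩
  have hx : x ∉ l' := (List.nodup_cons.1 (hp.nodup_iff.1 hl)).1
  have h : siteF x (cquery Φ (x, u, z))
      = fun D => siteF x (Φ (x, u - (D x).getD 0, z)) D := by
    have : cquery Φ (x, u, z) = siteF x fun D => siteF x (Φ (x, u - (D x).getD 0, z)) D := by
      funext D
      simp only [cquery, fiberQuery, siteF, update_idem, update_self]
      rfl
    rw [this, siteF_siteF]
  rw [decompress_perm hp, decompress_perm hp, decompress_cons, decompress_cons,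
    ← decompress_siteF hx, ← decompress_siteF hx, h,
    decompress_controlled hx fun d => siteF x (Φ (x, u - d.getD 0, z))]

namespace Algorithm

/-- The joint state after `i` rounds with the compressed oracle. -/
noncomputable def cstate (A : Algorithm X Y Z) : ℕ → CState X Y Z
  | 0 => fun b D => if D = fun _ => none then A.init b else 0
  | i + 1 => liftU (A.unitary i) (cquery (A.cstate i))

theorem ampl_cstate_le (A : Algorithm X Y Z) (i : ℕ) : ampl (A.cstate i) ≤ 1 := by
  induction i with
  | zero =>
    refine (sq_le_sq₀ (ampl_nonneg _) zero_le_one).1 (le_of_eq ?_)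
    rw [ampl_sq, one_pow, ← one_pow (M := ℝ) 2, ← A.norm_init, EuclideanSpace.norm_sq_eq]
    refine Finset.sum_congr rfl fun b _ => ?_
    rw [Finset.sum_eq_single fun _ => none] <;> simp +contextual [cstate]
  | succ i ih =>
    rw [cstate, ampl_liftU]
    exact (ampl_cquery_le _).trans ih

/-- Decompression turns the empty database into the uniform superposition of functions and
compressed queries into ordinary ones. The prefactor is the amplitude of one function in that
superposition. -/
theorem decompress_cstate (A : Algorithm X Y Z) {l : List X} (hl : l.Nodup)
    (hmem : ∀ x, x ∈ l) (f : X → Y) (i : ℕ) (b : X × Y × Z) :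
    decompress l (A.cstate i b) (fun x => some (f x))
      = (∏ _x : X, ((√(Fintype.card Y))⁻¹ : ℂ)) * A.state f i b := by
  induction i generalizing b with
  | zero =>
    have h : A.cstate 0 b = fun D => (if D = fun _ => none then 1 else 0) * A.init b := by
      funext D
      simp [cstate]
    have h2 : ∀ (l : List X) (g : (X → Option Y) → ℂ) (c : ℂ),
        decompress l (fun D => g D * c) = fun D => decompress l g D * c := by
      intro l g c
      induction l with
      | nil => rfl
      | cons x l ih =>
        rw [decompress_cons, ih]
        funext D
        simp only [decompress_cons, siteF, reflect, siteOverlap, sub_mul, Finset.mul_sum,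
          Finset.sum_mul, mul_assoc]
    rw [h, h2]
    simp only [decompress_empty hl]
    simp [hmem, state]
  | succ i ih =>
    have h := congrFun (congrFun (decompress_liftU l (A.unitary i) (cquery (A.cstate i))) b)
      fun x => some (f x)
    rw [cstate]
    refine h.trans ?_
    rw [state, liftU]
    have : (WithLp.toLp 2 fun b' => decompress l (cquery (A.cstate i) b') fun x => some (f x) :
        QState X Y Z)
        = (∏ _x : X, ((√(Fintype.card Y))⁻¹ : ℂ)) • oracle Z f (A.state f i) := by
      ext ⟨x, u, z⟩
      simp only [PiLp.smul_apply, smul_eq_mul]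
      rw [decompress_cquery _ hl hmem, ih]
      simp [oracle, queryPerm, LinearIsometryEquiv.piLpCongrLeft_apply, Equiv.piCongrLeft']
    rw [this, map_smul]
    rfl

end Algorithm

end Evolution

end QuantumQuery

namespace QuantumQuery

open Function
open scoped Classical

/-! ### Growth of the excess under compressed queries. -/

section Excess

set_option linter.unusedSectionVars false

variable {X Y Z : Type*} [Fintype X] [Fintype Y] [Fintype Z] [DecidableEq X]

/-- The number of entries of the database with value `y`. -/
noncomputable def valueCount (D : X → Option Y) (y : Y) : ℕ :=
  (Finset.univ.filter fun x => D x = some y).card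

/-- The number of entries in excess of `k` per value. -/
noncomputable def excess (k : ℕ) (D : X → Option Y) : ℕ := ∑ y, (valueCount D y - k)

theorem valueCount_update (D : X → Option Y) (x : X) (d : Option Y) (y : Y) :
    valueCount (update D x d) y
      = valueCount (update D x none) y + if d = some y then 1 else 0 := by
  have key : ∀ d : Option Y, valueCount (update D x d) y
      = (if d = some y then 1 else 0) + ∑ a ∈ Finset.univ.erase x,
        if D a = some y then 1 else 0 := by
    intro d
    rw [valueCount, Finset.card_filter, ← Finset.add_sum_erase _ _ (Finset.mem_univ x),
      update_self]
    congr 1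
    exact Finset.sum_congr rfl fun a ha => by rw [update_of_ne (Finset.ne_of_mem_erase ha)]
  rw [key, key none]
  simp [add_comm]

/-- Comparing with the database whose entry at `x` is erased makes the excess constant along a
fibre, plus one exactly on the values already occurring at least `k` times elsewhere. -/
theorem excess_update (k : ℕ) (D : X → Option Y) (x : X) (d : Option Y) :
    excess k (update D x d) = excess k (update D x none)
      + if ∃ y, d = some y ∧ k ≤ valueCount (update D x none) y then 1 else 0 := by
  have key : ∀ y, valueCount (update D x d) y - k = (valueCount (update D x none) y - k)
      + if d = some y ∧ k ≤ valueCount (update D x none) y then 1 else 0 := by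
    intro y
    rw [valueCount_update D x d]
    by_cases h1 : d = some y
    · by_cases h2 : k ≤ valueCount (update D x none) y
      · simp only [h1, h2, if_true, and_self]; omega
      · simp only [h1, h2, if_true, and_false, if_false]; omega
    · simp [h1]
  rw [excess, Finset.sum_congr rfl fun y _ => key y, Finset.sum_add_distrib]
  congr 1
  cases d with
  | none => simp
  | some y =>
    rw [Finset.sum_eq_single y]
    · simp
    · intro y' _ hy
      rw [if_neg]
      rintro ⟨h, -⟩
      exact hy (Option.some.inj h).symm
    · simp

theorem excess_update_none_le (k : ℕ) (D : X → Option Y) (x : X) :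
    excess k (update D x none) ≤ excess k D := by
  have := excess_update k D x (D x)
  rw [update_eq_self] at this
  omega

theorem excess_empty (k : ℕ) : excess k (fun _ : X => (none : Option Y)) = 0 := by
  simp [excess, valueCount]

theorem card_le_excess (k : ℕ) (D : X → Option Y) :
    (Finset.univ.filter fun y => k + 1 ≤ valueCount D y).card ≤ excess k D := by
  rw [Finset.card_filter]
  refine Finset.sum_le_sum fun y _ => ?_
  split_ifs <;> omega

/-- The link between levels: small excess over `k` leaves few values on which a query can raise the
excess over `k + 1`. -/
theorem card_update_le_of_excess_lt {k t : ℕ} {D : X → Option Y} (h : excess k D < t + 1) (x : X) :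
    (Finset.univ.filter fun y => k + 1 ≤ valueCount (update D x none) y).card ≤ t :=
  (card_le_excess k _).trans ((excess_update_none_le k D x).trans (Nat.lt_succ_iff.1 h))

variable [AddCommGroup Y]

/-- One compressed query raises the excess by at most one, with small amplitude. -/
theorem ampl_restrict_excess_cquery_le {k t : ℕ} (s : ℕ) {good : (X → Option Y) → Prop}
    (hgood : ∀ D, good D → ∀ x,
      (Finset.univ.filter fun y => k ≤ valueCount (update D x none) y).card ≤ t)
    (Φ : CState X Y Z) :
    ampl (restrict (fun D => s + 1 ≤ excess k D) (cquery (restrict good Φ)))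
      ≤ ampl (restrict (fun D => s + 1 ≤ excess k D) Φ)
        + 3 * √(t / Fintype.card Y) * ampl (restrict (fun D => s ≤ excess k D) Φ) := by
  set Φ₁ := restrict (fun D => s + 1 ≤ excess k D) (restrict good Φ) with hΦ₁
  set Φ₂ := restrict (fun D => ¬ s + 1 ≤ excess k D) (restrict good Φ) with hΦ₂
  rw [← restrict_add_restrict_not (fun D => s + 1 ≤ excess k D) (restrict good Φ), ← hΦ₁, ← hΦ₂,
    cquery_add, restrict_add]
  refine (ampl_add_le _ _).trans (add_le_add ?_ ?_)
  · refine (ampl_restrict_le _ _).trans ((ampl_cquery_le _).trans (ampl_mono fun b D => ?_))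
    simp only [hΦ₁, restrict]
    split_ifs <;> simp
  refine ampl_le_mul (by positivity) ?_
  rw [mul_pow, Real.sq_sqrt (by positivity)]
  simp only [Finset.mul_sum]
  refine sum_le_sum_of_fiber fun x z D => ?_
  simp only [← Finset.mul_sum]
  set D₀ := update D x none with hD₀
  set H : Finset Y := Finset.univ.filter fun y => k ≤ valueCount D₀ y with hH
  set φ : Y → Option Y → ℂ := fun v d => Φ₂ (x, v, z) (update D x d) with hφ
  have hex : ∀ d, excess k (update D x d)
      = excess k D₀ + if ∃ y, d = some y ∧ k ≤ valueCount D₀ y then 1 else 0 :=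
    excess_update k D x
  have hL : ∀ u, ∑ d, ‖restrict (fun D => s + 1 ≤ excess k D) (cquery Φ₂) (x, u, z)
        (update D x d)‖ ^ 2
      = ∑ d, if s + 1 ≤ excess k (update D x d) then ‖fiberQuery φ u d‖ ^ 2 else 0 := by
    intro u
    refine Finset.sum_congr rfl fun d _ => ?_
    simp only [restrict, cquery_update, ← hφ]
    split_ifs <;> simp
  simp only [hL]
  have hRnn : (0 : ℝ) ≤ 3 ^ 2 * ((t : ℝ) / Fintype.card Y) *
      ∑ u, ∑ d, ‖restrict (fun D => s ≤ excess k D) Φ (x, u, z) (update D x d)‖ ^ 2 := by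
    positivity
  -- On a nonzero fibre, some database is good and has excess at most `s`. It bounds the number of
  -- dangerous values and, unless level `s + 1` is unreachable there, fixes the base excess at
  -- exactly `s`.
  by_cases hzero : φ = 0
  · have : fiberQuery φ = 0 := by rw [hzero, fiberQuery_zero]
    simpa [this] using hRnn
  obtain ⟨u, hu⟩ := Function.ne_iff.1 hzero
  obtain ⟨d, hd⟩ := Function.ne_iff.1 hu
  have hd1 : ¬ s + 1 ≤ excess k (update D x d) := by
    exact fun h => hd (restrict_of_neg (not_not.2 h) _ _)
  have hd2 : good (update D x d) := by
    by_contra h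
    refine hd ((restrict_of_pos hd1 _ _).trans (restrict_of_neg h _ _))
  have hHt : H.card ≤ t := by
    have := hgood _ hd2 x
    rwa [update_idem] at this
  by_cases hs : excess k D₀ < s
  · have : ∀ d, ¬ s + 1 ≤ excess k (update D x d) := by
      intro d
      rw [hex]
      split_ifs <;> omega
    simpa [this] using hRnn
  have hs' : excess k D₀ = s := by
    have := hex d
    omega
  have hiff : ∀ d, s + 1 ≤ excess k (update D x d) ↔ ∃ y, d = some y ∧ k ≤ valueCount D₀ y := by
    intro d
    rw [hex]
    split_ifs with h
    · simp [h, hs']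
    · simp [h, hs']
  calc ∑ u, ∑ d, (if s + 1 ≤ excess k (update D x d) then ‖fiberQuery φ u d‖ ^ 2 else 0)
      = ∑ u, ∑ y ∈ H, ‖fiberQuery φ u (some y)‖ ^ 2 := by
        refine Finset.sum_congr rfl fun u _ => ?_
        rw [Fintype.sum_option, hH, Finset.sum_filter]
        simp [hiff]
    _ ≤ 8 * (H.card : ℝ) / Fintype.card Y * ∑ u, ∑ d, ‖φ u d‖ ^ 2 := by
        refine sum_norm_fiberQuery_sq_le H φ fun u y hy => ?_
        have : s + 1 ≤ excess k (update D x (some y)) :=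
          (hiff _).2 ⟨y, rfl, by simpa [hH] using hy⟩
        exact restrict_of_neg (not_not.2 this) _ _
    _ ≤ 3 ^ 2 * ((t : ℝ) / Fintype.card Y) *
        ∑ u, ∑ d, ‖restrict (fun D => s ≤ excess k D) Φ (x, u, z) (update D x d)‖ ^ 2 := by
        -- The constant 3 comes from 8 ≤ 3².
        rw [mul_div_assoc]
        refine mul_le_mul ?_ (Finset.sum_le_sum fun u _ => Finset.sum_le_sum fun d _ => ?_)
          (Finset.sum_nonneg fun _ _ => Finset.sum_nonneg fun _ _ => sq_nonneg _)
          (mul_nonneg (by norm_num) (div_nonneg (Nat.cast_nonneg _) (Nat.cast_nonneg _)))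
        · exact mul_le_mul (by norm_num)
            (div_le_div_of_nonneg_right (Nat.cast_le.2 hHt) (Nat.cast_nonneg _))
            (div_nonneg (Nat.cast_nonneg _) (Nat.cast_nonneg _)) (by norm_num)
        · have : s ≤ excess k (update D x d) := by rw [hex]; omega
          rw [restrict_of_pos (P := fun D => s ≤ excess k D) this]
          exact pow_le_pow_left₀ (norm_nonneg _)
            ((norm_restrict_le _ _ _ _).trans (norm_restrict_le _ _ _ _)) 2

namespace Algorithm

/-- The joint state after `i` rounds, truncated to good databases before each query. -/
noncomputable def truncState (A : Algorithm X Y Z) (good : (X → Option Y) → Prop) :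
    ℕ → CState X Y Z
  | 0 => A.cstate 0
  | i + 1 => liftU (A.unitary i) (cquery (restrict good (A.truncState good i)))

theorem ampl_truncState_le (A : Algorithm X Y Z) (good : (X → Option Y) → Prop) (i : ℕ) :
    ampl (A.truncState good i) ≤ 1 := by
  induction i with
  | zero => exact A.ampl_cstate_le 0
  | succ i ih =>
    rw [truncState, ampl_liftU]
    exact (ampl_cquery_le _).trans ((ampl_restrict_le _ _).trans ih)

/-- The error made by truncating. -/
theorem exists_cstate_eq_truncState_add (A : Algorithm X Y Z) (good : (X → Option Y) → Prop)
    (i : ℕ) : ∃ Ψ : CState X Y Z, A.cstate i = A.truncState good i + Ψ ∧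
      ampl Ψ ≤ ∑ i' ∈ Finset.range i, ampl (restrict (fun D => ¬ good D) (A.cstate i')) := by
  induction i with
  | zero =>
    refine ⟨0, by rw [add_zero]; rfl, ?_⟩
    simp
  | succ i ih =>
    obtain ⟨Ψ, h, hΨ⟩ := ih
    refine ⟨liftU (A.unitary i) (cquery (restrict good Ψ +
      restrict (fun D => ¬ good D) (A.cstate i))), ?_, ?_⟩
    · rw [cstate, truncState, ← liftU_add, ← cquery_add, ← add_assoc, ← restrict_add, ← h,
        restrict_add_restrict_not]
    · rw [ampl_liftU, Finset.sum_range_succ]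
      refine (ampl_cquery_le _).trans ((ampl_add_le _ _).trans (add_le_add ?_ le_rfl))
      exact (ampl_restrict_le _ _).trans hΨ

/-- The one-query estimate is Pascal's recurrence with weight `3 * √(t / N)` for each step up. -/
theorem ampl_restrict_excess_truncState_le (A : Algorithm X Y Z) {k t : ℕ}
    {good : (X → Option Y) → Prop}
    (hgood : ∀ D, good D → ∀ x,
      (Finset.univ.filter fun y => k ≤ valueCount (update D x none) y).card ≤ t) (i s : ℕ) :
    ampl (restrict (fun D => s ≤ excess k D) (A.truncState good i))
      ≤ i.choose s * (3 * √(t / Fintype.card Y)) ^ s := by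
  induction i generalizing s with
  | zero =>
    cases s with
    | zero =>
      simpa using (ampl_restrict_le _ _).trans (A.ampl_truncState_le good 0)
    | succ s =>
      have : restrict (fun D => s + 1 ≤ excess k D) (A.truncState good 0) = 0 := by
        funext b D
        by_cases h : D = fun _ => none
        · refine restrict_of_neg ?_ _ _
          rw [h, excess_empty]
          omega
        · have h0 : A.truncState good 0 b D = 0 := if_neg h
          exact norm_le_zero_iff.1 ((norm_restrict_le _ _ _ _).trans (by simp [h0]))
      rw [this]
      simp
  | succ i ih =>
    cases s with
    | zero => simpa using (ampl_restrict_le _ _).trans (A.ampl_truncState_le good (i + 1))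
    | succ s =>
      rw [truncState, restrict_liftU, ampl_liftU]
      refine (ampl_restrict_excess_cquery_le s hgood _).trans ?_
      refine (add_le_add (ih (s + 1)) (mul_le_mul_of_nonneg_left (ih s) (by positivity))).trans_eq
        ?_
      rw [Nat.choose_succ_succ]
      push_cast
      ring

/-- The amplitude of a large excess after `i` compressed queries. -/
theorem ampl_restrict_excess_le (A : Algorithm X Y Z) {k t : ℕ}
    {good : (X → Option Y) → Prop}
    (hgood : ∀ D, good D → ∀ x,
      (Finset.univ.filter fun y => k ≤ valueCount (update D x none) y).card ≤ t) (i s : ℕ) :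
    ampl (restrict (fun D => s ≤ excess k D) (A.cstate i))
      ≤ i.choose s * (3 * √(t / Fintype.card Y)) ^ s
        + ∑ i' ∈ Finset.range i, ampl (restrict (fun D => ¬ good D) (A.cstate i')) := by
  obtain ⟨Ψ, h, hΨ⟩ := A.exists_cstate_eq_truncState_add good i
  rw [h, restrict_add]
  exact (ampl_add_le _ _).trans (add_le_add (A.ampl_restrict_excess_truncState_le hgood i s)
    ((ampl_restrict_le _ _).trans hΨ))

/-- Base of the recursion. With every database good and `t = N` nothing is truncated, and the
binomial coefficient vanishes. -/
theorem ampl_restrict_excess_zero (A : Algorithm X Y Z) {i s : ℕ} (h : i < s) :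
    ampl (restrict (fun D => s ≤ excess 0 D) (A.cstate i)) = 0 := by
  refine le_antisymm ?_ (ampl_nonneg _)
  have := A.ampl_restrict_excess_le (k := 0) (good := fun _ => True) (t := Fintype.card Y)
    (fun D _ x => Finset.card_le_univ _) i s
  refine this.trans_eq ?_
  have h0 : ∀ Φ : CState X Y Z, restrict (fun _ => False) Φ = 0 := fun Φ => by
    funext b D; simp [restrict]
  rw [Nat.choose_eq_zero_of_lt h]
  simp only [not_true_eq_false, h0]
  simp

end Algorithm

end Excess

end QuantumQuery

namespace QuantumQuery

open Function
open scoped Classical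

/-! ### From recorded collisions to success probability. -/

section Collisions

set_option linter.unusedSectionVars false

variable {X Y Z : Type*} [Fintype X] [Fintype Y] [Fintype Z] [DecidableEq X]

/-- The database records `j` distinct `3`-collisions, forming the family `C`. -/
def IsRecordedFamily (j : ℕ) (C : Finset (Finset X)) (D : X → Option Y) : Prop :=
  C.card = j ∧ ∀ S ∈ C, S.card = 3 ∧ ∃ y, ∀ x ∈ S, D x = some y

theorem card_biUnion_le_of_isRecordedFamily {j : ℕ} {C : Finset (Finset X)} {D : X → Option Y}
    (h : IsRecordedFamily j C D) : (C.biUnion id).card ≤ 3 * j := by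
  refine (Finset.card_biUnion_le_card_mul C id 3 fun S hS => (h.2 S hS).1.le).trans_eq ?_
  rw [h.1, mul_comm]

/-- Each input in a claimed triple has its value pinned by another member of that triple, and at
most `3 * j` inputs are involved. -/
theorem l2norm_recorded_decompress_le [Nonempty Y] (j : ℕ) (C : Finset (Finset X)) {l : List X}
    (hl : l.Nodup) (g : (X → Option Y) → ℂ) :
    l2norm (fun D => if IsRecordedFamily j C D then decompress l g D else 0)
      ≤ l2norm (fun D => if IsRecordedFamily j C D then g D else 0)
        + 3 * j * √(2 / Fintype.card Y) * l2norm g := by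
  by_cases hC : ∃ D : X → Option Y, IsRecordedFamily j C D
  · obtain ⟨D₀, hD₀⟩ := hC
    refine (l2norm_restrict_decompress_le (C.biUnion id) _ ?_ ?_ ?_ hl g).trans ?_
    · intro x hx D hD
      obtain ⟨S, hS, hxS⟩ := Finset.mem_biUnion.1 hx
      obtain ⟨-, y, hy⟩ := hD.2 S hS
      rw [hy x hxS]
      simp
    · intro x hx D y y' h h'
      obtain ⟨S, hS, hxS⟩ := Finset.mem_biUnion.1 hx
      obtain ⟨hS3, v, hv⟩ := h.2 S hS
      obtain ⟨-, v', hv'⟩ := h'.2 S hS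
      obtain ⟨x', hx'S, hne⟩ := Finset.exists_mem_ne (by omega : 1 < S.card) x
      have h1 := hv x hxS
      have h2 := hv x' hx'S
      have h1' := hv' x hxS
      have h2' := hv' x' hx'S
      rw [update_self] at h1 h1'
      rw [update_of_ne hne] at h2 h2'
      rw [h2] at h2'
      rw [← h1] at h2'
      rw [← h1'] at h2'
      exact Option.some.inj h2'
    · intro x hx D d
      have : ∀ S ∈ C, ∀ x' ∈ S, update D x d x' = D x' := fun S hS x' hx' =>
        update_of_ne (fun h : x' = x =>
          hx (Finset.mem_biUnion.2 ⟨S, hS, by rw [← h]; exact hx'⟩)) _ _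
      refine and_congr_right fun _ => forall₂_congr fun S hS => and_congr_right fun _ =>
        exists_congr fun y => forall₂_congr fun x' hx' => ?_
      rw [this S hS x' hx']
    · have h : ((C.biUnion id).card : ℝ) ≤ 3 * j := by
        exact_mod_cast card_biUnion_le_of_isRecordedFamily hD₀
      gcongr
      exact l2norm_nonneg g
  · push Not at hC
    simp only [hC, if_false]
    have h0 := l2norm_nonneg g
    have : 0 ≤ 3 * (j : ℝ) * √(2 / Fintype.card Y) * l2norm g := by positivity
    linarith

/-- The linear term suffices up to `c = 4`, where it is tight; from `c = 5` on the cubic term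
suffices alone, and 10 is the number of triples at `c = 5`. -/
theorem choose_three_le (c : ℕ) : c.choose 3 ≤ 2 * (c - 2) + 10 * (c - 4) ^ 3 := by
  rcases lt_or_ge c 5 with h | h
  · interval_cases c <;> decide
  · obtain ⟨m, rfl⟩ := Nat.exists_eq_add_of_le h
    have e : 5 + m - 4 = m + 1 := by omega
    have h1 : (5 + m).choose 3 * 6 = (5 + m) * (4 + m) * (3 + m) := by
      have := Nat.descFactorial_eq_factorial_mul_choose (5 + m) 3
      simp [Nat.descFactorial, Nat.factorial] at this
      have a2 : 5 + m - 2 = 3 + m := by omega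
      rw [a2] at this
      linarith
    have h2 : (5 + m).choose 3 ≤ 10 * (m + 1) ^ 3 := by nlinarith [Nat.zero_le m, sq_nonneg m]
    rw [e]
    omega

/-- Every recorded triple lies in the preimage of one value, so the triples are counted by binomial
coefficients; a sum of cubes is at most the cube of the sum. -/
theorem le_excess_of_isRecordedFamily {j : ℕ} {C : Finset (Finset X)} {D : X → Option Y}
    (h : IsRecordedFamily j C D) : j ≤ 2 * excess 2 D + 10 * excess 4 D ^ 3 := by
  have hsub : C ⊆ Finset.univ.biUnion fun y =>
      (Finset.univ.filter fun x => D x = some y).powersetCard 3 := by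
    intro S hS
    obtain ⟨hS3, y, hy⟩ := h.2 S hS
    refine Finset.mem_biUnion.2 ⟨y, Finset.mem_univ y, Finset.mem_powersetCard.2 ⟨?_, hS3⟩⟩
    intro x hx
    simpa using hy x hx
  calc j = C.card := h.1.symm
    _ ≤ ∑ y, ((Finset.univ.filter fun x => D x = some y).powersetCard 3).card :=
        (Finset.card_le_card hsub).trans Finset.card_biUnion_le
    _ ≤ ∑ y, (2 * (valueCount D y - 2) + 10 * (valueCount D y - 4) ^ 3) := by
        refine Finset.sum_le_sum fun y _ => ?_
        rw [Finset.card_powersetCard]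
        exact choose_three_le _
    _ = 2 * excess 2 D + 10 * ∑ y, (valueCount D y - 4) ^ 3 := by
        rw [Finset.sum_add_distrib, ← Finset.mul_sum, ← Finset.mul_sum]
        rfl
    _ ≤ _ := by
        gcongr
        calc ∑ y, (valueCount D y - 4) ^ 3
            ≤ ∑ y, (valueCount D y - 4) * excess 4 D ^ 2 := by
              refine Finset.sum_le_sum fun y _ => ?_
              rw [pow_succ']
              gcongr
              exact Finset.single_le_sum (f := fun y => valueCount D y - 4)
                (fun _ _ => Nat.zero_le _) (Finset.mem_univ y)
          _ = _ := by rw [← Finset.sum_mul, ← excess, pow_succ' _ 2]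

variable [AddCommGroup Y]

/-- The success probability is controlled by the weight on databases that record a family. -/
theorem successProb_le (A : Algorithm X Y Z) (j : ℕ) {E : (X → Option Y) → Prop}
    (hE : ∀ C D, IsRecordedFamily j C D → E D) :
    successProb A 3 j ≤ 2 * ampl (restrict E (A.cstate A.queries)) ^ 2
      + 36 * (j : ℝ) ^ 2 / Fintype.card Y := by
  set Φ := A.cstate A.queries with hΦ
  set l := (Finset.univ : Finset X).toList with hl
  have hnd : l.Nodup := Finset.nodup_toList _
  have hmem : ∀ x, x ∈ l := fun x => Finset.mem_toList.2 (Finset.mem_univ x)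
  set ε : ℝ := 3 * j * √(2 / Fintype.card Y) with hε
  have hε2 : ε ^ 2 = 18 * (j : ℝ) ^ 2 / Fintype.card Y := by
    rw [hε, mul_pow, Real.sq_sqrt (by positivity)]
    ring
  have hcard : ∀ z : ℂ, ‖(∏ _x : X, ((√(Fintype.card Y))⁻¹ : ℂ)) * z‖ ^ 2
      = ‖z‖ ^ 2 / Fintype.card (X → Y) := by
    intro z
    rw [norm_mul, mul_pow, Finset.prod_const, norm_pow, ← pow_mul, mul_comm _ 2, pow_mul,
      norm_inv, inv_pow, Complex.norm_real, Real.norm_eq_abs, sq_abs,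
      Real.sq_sqrt (Nat.cast_nonneg _), Fintype.card_fun, Finset.card_univ]
    push_cast
    rw [inv_pow]
    ring
  have hinj : Injective fun (f : X → Y) (x : X) => some (f x) := fun f f' h =>
    funext fun x => Option.some.inj (congrFun h x)
  calc successProb A 3 j
      = ∑ b, ∑ f : X → Y, if IsCollisionFamily 3 j f (A.output b) then
          ‖decompress l (Φ b) fun x => some (f x)‖ ^ 2 else 0 := by
        rw [successProb, Finset.sum_div, Finset.sum_comm]
        refine Finset.sum_congr rfl fun f _ => ?_
        rw [Algorithm.outputProb, Finset.sum_div]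
        refine Finset.sum_congr rfl fun b _ => ?_
        rw [A.decompress_cstate hnd hmem, hcard]
        split_ifs <;> simp
    _ ≤ ∑ b, ∑ f : X → Y, ‖if IsRecordedFamily j (A.output b) (fun x => some (f x)) then
          decompress l (Φ b) (fun x => some (f x)) else 0‖ ^ 2 := by
        refine Finset.sum_le_sum fun b _ => Finset.sum_le_sum fun f _ => ?_
        by_cases h : IsCollisionFamily 3 j f (A.output b)
        · rw [if_pos h, if_pos]
          refine ⟨h.1, fun S hS => ⟨(h.2 S hS).1, ?_⟩⟩
          obtain ⟨x₀, hx₀⟩ := Finset.card_pos.1 (by rw [(h.2 S hS).1]; norm_num : 0 < S.card)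
          exact ⟨f x₀, fun x hx => congrArg some ((h.2 S hS).2 x hx x₀ hx₀)⟩
        · rw [if_neg h]
          positivity
    -- Total functions embed in the set of databases, and enlarging the sum allows the norm estimate
    -- on all databases.
    _ ≤ ∑ b, ∑ D, ‖if IsRecordedFamily j (A.output b) D then
          decompress l (Φ b) D else 0‖ ^ 2 := by
        refine Finset.sum_le_sum fun b _ => ?_
        exact (Finset.sum_map Finset.univ ⟨_, hinj⟩ fun D =>
          ‖if IsRecordedFamily j (A.output b) D then decompress l (Φ b) D else 0‖ ^ 2).symm.trans_le
          (Finset.sum_le_univ_sum_of_nonneg fun _ => by positivity)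
    _ ≤ ∑ b, (2 * ∑ D, ‖restrict E Φ b D‖ ^ 2 + 2 * ε ^ 2 * ∑ D, ‖Φ b D‖ ^ 2) := by
        refine Finset.sum_le_sum fun b _ => ?_
        rw [← l2norm_sq, ← l2norm_sq, ← l2norm_sq]
        have h1 := l2norm_recorded_decompress_le j (A.output b) hnd (Φ b)
        have h2 : l2norm (fun D => if IsRecordedFamily j (A.output b) D then Φ b D else 0)
            ≤ l2norm (restrict E Φ b) := by
          refine l2norm_le_of_sum_le (Finset.sum_le_sum fun D _ => ?_)
          by_cases h : IsRecordedFamily j (A.output b) D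
          · rw [if_pos h, restrict_of_pos (hE _ _ h)]
          · rw [if_neg h]
            simp
        have h3 := h1.trans (add_le_add_left h2 _)
        refine (pow_le_pow_left₀ (l2norm_nonneg _) h3 2).trans (add_sq_le.trans_eq ?_)
        rw [← hε]
        ring
    _ = 2 * ampl (restrict E Φ) ^ 2 + 2 * ε ^ 2 * ampl Φ ^ 2 := by
        rw [Finset.sum_add_distrib, ← Finset.mul_sum, ← Finset.mul_sum, ampl_sq, ampl_sq]
    _ ≤ 2 * ampl (restrict E Φ) ^ 2 + 2 * ε ^ 2 * 1 := by
        gcongr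
        exact pow_le_one₀ (ampl_nonneg _) (A.ampl_cstate_le _)
    _ = _ := by rw [hε2]; ring

theorem ampl_restrict_or_sq_le (P Q : (X → Option Y) → Prop) (Φ : CState X Y Z) :
    ampl (restrict (fun D => P D ∨ Q D) Φ) ^ 2
      ≤ ampl (restrict P Φ) ^ 2 + ampl (restrict Q Φ) ^ 2 := by
  simp only [ampl_sq, ← Finset.sum_add_distrib]
  refine Finset.sum_le_sum fun b _ => Finset.sum_le_sum fun D _ => ?_
  by_cases hP : P D
  · rw [restrict_of_pos (P := fun D => P D ∨ Q D) (Or.inl hP), restrict_of_pos hP]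
    linarith [sq_nonneg ‖restrict Q Φ b D‖]
  · by_cases hQ : Q D
    · rw [restrict_of_pos (P := fun D => P D ∨ Q D) (Or.inr hQ), restrict_of_pos hQ]
      linarith [sq_nonneg ‖restrict P Φ b D‖]
    · rw [restrict_of_neg (P := fun D => P D ∨ Q D) (by tauto), norm_zero, zero_pow two_ne_zero]
      positivity

end Collisions

end QuantumQuery

namespace QuantumQuery

open Function Filter Topology
open scoped Classical

/-! ### Thresholds and asymptotics. -/

section Bound

/-- The binomial is at most q^s / s!, and s^s / s! ≤ e^s ≤ 3^s; hence the factor 3 in the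
hypothesis. -/
theorem choose_mul_pow_le {q s : ℕ} {κ δ : ℝ} (hκ : 0 ≤ κ) (hδ : 0 ≤ δ) (h : 3 * (q * κ) ≤ δ * s) :
    q.choose s * κ ^ s ≤ δ ^ s := by
  have hs : (0 : ℝ) < s.factorial := by exact_mod_cast s.factorial_pos
  have he : Real.exp s ≤ 3 ^ s := by
    rw [← mul_one (s : ℝ), Real.exp_nat_mul]
    exact pow_le_pow_left₀ (Real.exp_pos _).le (Real.exp_one_lt_d9.le.trans (by norm_num)) s
  have h1 : q * κ ≤ δ / 3 * s := by linarith
  calc q.choose s * κ ^ s ≤ (q : ℝ) ^ s / s.factorial * κ ^ s := by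
        gcongr
        exact Nat.choose_le_pow_div s q
    _ = (q * κ) ^ s / s.factorial := by rw [mul_pow]; ring
    _ ≤ (δ / 3 * s) ^ s / s.factorial := by gcongr
    _ = (δ / 3) ^ s * ((s : ℝ) ^ s / s.factorial) := by rw [mul_pow]; ring
    _ ≤ (δ / 3) ^ s * 3 ^ s := by
        gcongr
        exact (Real.pow_div_factorial_le_exp (s : ℝ) (Nat.cast_nonneg s) s).trans he
    _ = δ ^ s := by rw [← mul_pow]; congr 1; ring

variable {X Y Z : Type*} [Fintype X] [Fintype Y] [Fintype Z] [DecidableEq X] [AddCommGroup Y]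

namespace Algorithm

/-- Passing from the excess over `k` to the excess over `k + 1`. -/
theorem ampl_restrict_excess_succ_le (A : Algorithm X Y Z) {k t s q : ℕ} {δ η : ℝ} (hδ : 0 ≤ δ)
    (hbad : ∀ i ≤ q, ampl (restrict (fun D => t + 1 ≤ excess k D) (A.cstate i)) ≤ η)
    (h : 9 * (q * √(t / Fintype.card Y)) ≤ δ * s) {i : ℕ} (hi : i ≤ q) :
    ampl (restrict (fun D => s ≤ excess (k + 1) D) (A.cstate i)) ≤ δ ^ s + q * η := by
  have hη : 0 ≤ η := (ampl_nonneg _).trans (hbad 0 (Nat.zero_le q))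
  have h1 := A.ampl_restrict_excess_le (k := k + 1) (t := t)
    (good := fun D => excess k D < t + 1) (fun D hD x => card_update_le_of_excess_lt hD x) i s
  refine h1.trans (add_le_add (choose_mul_pow_le (by positivity) hδ ?_) ?_)
  · have hiq : (i : ℝ) ≤ q := by exact_mod_cast hi
    calc 3 * ((i : ℝ) * (3 * √(t / Fintype.card Y))) = 9 * (i * √(t / Fintype.card Y)) := by ring
      _ ≤ 9 * (q * √(t / Fintype.card Y)) := by gcongr
      _ ≤ _ := h
  · simp only [not_lt]
    calc ∑ i' ∈ Finset.range i, ampl (restrict (fun D => t + 1 ≤ excess k D) (A.cstate i'))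
        ≤ ∑ _i' ∈ Finset.range i, η := Finset.sum_le_sum fun i' hi' =>
          hbad i' ((Finset.mem_range.1 hi').le.trans hi)
      _ = i * η := by simp
      _ ≤ q * η := by gcongr

/-- The success probability in terms of thresholds on the number of pairs, triples, quadruples and
quintuples in the database. -/
theorem successProb_le_of_thresholds (A : Algorithm X Y Z) {j t₁ t₂ t₃ s₂ s₄ : ℕ} {δ e : ℝ}
    (hδ : 0 ≤ δ) (hδ1 : δ ≤ 1) (ht₁ : δ ^ t₁ ≤ e) (ht₂ : δ ^ t₂ ≤ e) (ht₃ : δ ^ t₃ ≤ e)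
    (hs₂ : 1 ≤ s₂) (hs₄ : 1 ≤ s₄)
    (h₁ : 9 * (A.queries * √(A.queries / Fintype.card Y)) ≤ δ * t₁)
    (h₂ : 9 * (A.queries * √(t₁ / Fintype.card Y)) ≤ δ * t₂)
    (h₂' : 9 * (A.queries * √(t₁ / Fintype.card Y)) ≤ δ * s₂)
    (h₃ : 9 * (A.queries * √(t₂ / Fintype.card Y)) ≤ δ * t₃)
    (h₄ : 9 * (A.queries * √(t₃ / Fintype.card Y)) ≤ δ * s₄)
    (hj : ∀ m n : ℕ, m < s₂ → n < s₄ → 2 * m + 10 * n ^ 3 < j) :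
    successProb A 3 j ≤ 2 * ((δ + A.queries * e) ^ 2
      + (δ + A.queries * (e + A.queries * (e + A.queries * e))) ^ 2)
      + 36 * (j : ℝ) ^ 2 / Fintype.card Y := by
  set q := A.queries with hq
  have hsucc : ∀ {t : ℕ}, δ ^ t ≤ e → δ ^ (t + 1) ≤ e := fun h =>
    (pow_le_pow_of_le_one hδ hδ1 (Nat.le_succ _)).trans h
  have hsucc' : ∀ {x : ℝ} {t : ℕ}, x ≤ δ * t → x ≤ δ * (t + 1 : ℕ) := fun h =>
    h.trans (by push_cast; gcongr; linarith)
  -- The final thresholds may equal 1 when `j` is small, so only one factor `δ` is gained there.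
  have hone : ∀ {s : ℕ}, 1 ≤ s → δ ^ s ≤ δ := fun h => by
    simpa using pow_le_pow_of_le_one hδ hδ1 h
  have b₀ : ∀ i ≤ q, ampl (restrict (fun D => q + 1 ≤ excess 0 D) (A.cstate i)) ≤ 0 :=
    fun i hi => (A.ampl_restrict_excess_zero (Nat.lt_succ_of_le hi)).le
  have b₁ : ∀ i ≤ q, ampl (restrict (fun D => t₁ + 1 ≤ excess 1 D) (A.cstate i)) ≤ e :=
    fun i hi => (A.ampl_restrict_excess_succ_le hδ b₀ (hsucc' h₁) hi).trans
      (by rw [mul_zero, add_zero]; exact hsucc ht₁)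
  have b₂ : ∀ i ≤ q, ampl (restrict (fun D => t₂ + 1 ≤ excess 2 D) (A.cstate i)) ≤ e + q * e :=
    fun i hi => (A.ampl_restrict_excess_succ_le hδ b₁ (hsucc' h₂) hi).trans
      (add_le_add (hsucc ht₂) le_rfl)
  have b₃ : ∀ i ≤ q, ampl (restrict (fun D => t₃ + 1 ≤ excess 3 D) (A.cstate i))
      ≤ e + q * (e + q * e) :=
    fun i hi => (A.ampl_restrict_excess_succ_le hδ b₂ (hsucc' h₃) hi).trans
      (add_le_add (hsucc ht₃) le_rfl)
  have f₂ : ampl (restrict (fun D => s₂ ≤ excess 2 D) (A.cstate q)) ≤ δ + q * e :=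
    (A.ampl_restrict_excess_succ_le hδ b₁ h₂' le_rfl).trans (add_le_add (hone hs₂) le_rfl)
  have f₄ : ampl (restrict (fun D => s₄ ≤ excess 4 D) (A.cstate q))
      ≤ δ + q * (e + q * (e + q * e)) :=
    (A.ampl_restrict_excess_succ_le hδ b₃ h₄ le_rfl).trans (add_le_add (hone hs₄) le_rfl)
  have hE : ∀ (C : Finset (Finset X)) (D : X → Option Y), IsRecordedFamily j C D →
      s₂ ≤ excess 2 D ∨ s₄ ≤ excess 4 D := by
    intro C D h
    by_contra! hlt
    exact absurd (le_excess_of_isRecordedFamily h) (not_le.2 (hj _ _ hlt.1 hlt.2))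
  refine (successProb_le A j hE).trans ?_
  have h := ampl_restrict_or_sq_le (fun D => s₂ ≤ excess 2 D) (fun D => s₄ ≤ excess 4 D)
    (A.cstate q)
  have g₂ := pow_le_pow_left₀ (ampl_nonneg _) f₂ 2
  have g₄ := pow_le_pow_left₀ (ampl_nonneg _) f₄ 2
  rw [← hq]
  linarith

end Algorithm

/-- The numerical condition on consecutive thresholds, for powers of the size of the range. -/
theorem nine_mul_sqrt_le {a δ q t s α β γ : ℝ} (ha : 1 ≤ a) (hδ : 0 ≤ δ)
    (hq : q ≤ δ / 100 * a ^ α) (ht : t ≤ 2 * a ^ β) (hs : a ^ γ / 4 ≤ s)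
    (h : α + β / 2 - 1 / 2 ≤ γ) : 9 * (q * √(t / a)) ≤ δ * s := by
  have ha0 : 0 < a := by linarith
  have h1 : √(t / a) ≤ 2 * a ^ (β / 2 - 1 / 2) := by
    refine Real.sqrt_le_iff.2 ⟨by positivity, ?_⟩
    rw [mul_pow, ← Real.rpow_natCast (a ^ (β / 2 - 1 / 2)) 2, ← Real.rpow_mul ha0.le, div_le_iff₀ ha0]
    have : a ^ ((β / 2 - 1 / 2) * (2 : ℕ)) * a = a ^ β := by
      nth_rw 2 [← Real.rpow_one a]
      rw [← Real.rpow_add ha0]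
      congr 1
      push_cast
      ring
    rw [mul_assoc, this]
    have := Real.rpow_pos_of_pos ha0 β
    linarith
  calc 9 * (q * √(t / a)) ≤ 9 * (δ / 100 * a ^ α * (2 * a ^ (β / 2 - 1 / 2))) := by gcongr
    _ = 18 / 100 * δ * a ^ (α + β / 2 - 1 / 2) := by
        rw [add_sub_assoc, Real.rpow_add ha0]; ring
    _ ≤ 18 / 100 * δ * a ^ γ := by gcongr
    _ ≤ 1 / 4 * δ * a ^ γ := by
        have := mul_nonneg hδ (Real.rpow_nonneg ha0.le γ)
        linarith
    _ = δ * (a ^ γ / 4) := by ring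
    _ ≤ δ * s := by gcongr

/-- With m the ceiling of N^(1/16), N³ ≤ m^48 and δ^m beats this power. The cube absorbs the factors
`q` accumulated over three levels. -/
theorem eventually_pow_mul_pow_ceil_le {δ : ℝ} (hδ : 0 < δ) (hδ1 : δ < 1) :
    ∀ᶠ N : ℕ in atTop, 3 * (N : ℝ) ^ 3 * δ ^ ⌈(N : ℝ) ^ (1 / 16 : ℝ)⌉₊ ≤ δ := by
  have h1 : Tendsto (fun N : ℕ => ⌈(N : ℝ) ^ (1 / 16 : ℝ)⌉₊) atTop atTop :=
    tendsto_nat_ceil_atTop.comp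
      ((tendsto_rpow_atTop (by norm_num : (0 : ℝ) < 1 / 16)).comp tendsto_natCast_atTop_atTop)
  have h2 : Tendsto (fun m : ℕ => (m : ℝ) ^ 48 * δ ^ m) atTop (𝓝 0) :=
    tendsto_pow_const_mul_const_pow_of_abs_lt_one 48 (by rwa [abs_of_pos hδ])
  filter_upwards [(h2.comp h1).eventually_le_const (by positivity : 0 < δ / 3)] with N hN
  have h3 : (N : ℝ) ≤ (⌈(N : ℝ) ^ (1 / 16 : ℝ)⌉₊ : ℝ) ^ 16 := by
    calc (N : ℝ) = ((N : ℝ) ^ (1 / 16 : ℝ)) ^ 16 := by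
          rw [← Real.rpow_natCast, ← Real.rpow_mul (Nat.cast_nonneg N)]
          norm_num
      _ ≤ _ := by gcongr; exact Nat.le_ceil _
  have h4 : (N : ℝ) ^ 3 ≤ (⌈(N : ℝ) ^ (1 / 16 : ℝ)⌉₊ : ℝ) ^ 48 := by
    calc (N : ℝ) ^ 3 ≤ ((⌈(N : ℝ) ^ (1 / 16 : ℝ)⌉₊ : ℝ) ^ 16) ^ 3 := by gcongr
      _ = _ := by rw [← pow_mul]
  have h5 := mul_le_mul_of_nonneg_right h4 (pow_nonneg hδ.le ⌈(N : ℝ) ^ (1 / 16 : ℝ)⌉₊)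
  simp only [comp_apply] at hN
  linarith

theorem eventually_rpow_le {δ : ℝ} (hδ : 0 < δ) :
    ∀ᶠ N : ℕ in atTop, 36 * (N : ℝ) ^ (-(3 / 4) : ℝ) ≤ δ ^ 2 := by
  have h := (tendsto_rpow_neg_atTop (by norm_num : (0 : ℝ) < 3 / 4)).comp
    tendsto_natCast_atTop_atTop
  filter_upwards [h.eventually_le_const (by positivity : 0 < δ ^ 2 / 36)] with N hN
  simp only [comp_apply] at hN
  linarith

theorem ceil_le_two_mul_rpow {a β : ℝ} (ha : 1 ≤ a) (hβ : 0 ≤ β) :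
    (⌈a ^ β⌉₊ : ℝ) ≤ 2 * a ^ β := by
  have h1 := Real.one_le_rpow ha hβ
  have h2 := Nat.ceil_lt_add_one (zero_le_one.trans h1)
  linarith

/-- An algorithm with few queries succeeds with small probability. -/
theorem successProb_le_of_queries_lt (A : Algorithm X Y Z) {N j : ℕ} {δ : ℝ} (hδ : 0 < δ)
    (hδ1 : δ < 1) (hN : Fintype.card Y = N) (hN2 : 2 ≤ N) (hj1 : 1 ≤ j)
    (hj : (j : ℝ) ≤ (N : ℝ) ^ (1 / 8 : ℝ))
    (hN₁ : 3 * (N : ℝ) ^ 3 * δ ^ ⌈(N : ℝ) ^ (1 / 16 : ℝ)⌉₊ ≤ δ)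
    (hN₂ : 36 * (N : ℝ) ^ (-(3 / 4) : ℝ) ≤ δ ^ 2)
    (hq : (A.queries : ℝ) < δ / 100 * (j : ℝ) ^ (4 / 7 : ℝ) * (N : ℝ) ^ (3 / 7 : ℝ)) :
    successProb A 3 j ≤ 17 * δ ^ 2 := by
  set a : ℝ := (N : ℝ) with ha_def
  have ha2 : 2 ≤ a := by rw [ha_def]; exact_mod_cast hN2
  have ha1 : 1 < a := by linarith
  have ha0 : 0 < a := by linarith
  have hlog : 0 < Real.log a := Real.log_pos ha1
  have hj1' : (1 : ℝ) ≤ j := by exact_mod_cast hj1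
  -- Writing j = N^θ turns the threshold conditions into linear inequalities in θ on [0, 1/8].
  obtain ⟨θ, hθ⟩ : ∃ θ : ℝ, a ^ θ = j :=
    ⟨Real.logb a j, Real.rpow_logb ha0 ha1.ne' (by linarith)⟩
  have hθ0 : 0 ≤ θ := by
    rw [← hθ, ← Real.rpow_zero a] at hj1'
    exact (Real.rpow_le_rpow_left_iff ha1).1 hj1'
  have hθ1 : θ ≤ 1 / 8 := by
    rw [← hθ] at hj
    exact (Real.rpow_le_rpow_left_iff ha1).1 hj
  have hq' : (A.queries : ℝ) ≤ δ / 100 * a ^ (4 / 7 * θ + 3 / 7) := by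
    rw [← hθ, ← Real.rpow_mul ha0.le, mul_assoc, ← Real.rpow_add ha0] at hq
    rw [mul_comm (4 / 7) θ]
    exact hq.le
  have hqa : (A.queries : ℝ) ≤ a := by
    have h1 : a ^ (4 / 7 * θ + 3 / 7) ≤ a ^ (1 : ℝ) :=
      Real.rpow_le_rpow_of_exponent_le ha1.le (by linarith)
    rw [Real.rpow_one] at h1
    have h2 : δ / 100 * a ^ (4 / 7 * θ + 3 / 7) ≤ 1 * a := by
      gcongr
      linarith
    linarith
  have hq0 : (0 : ℝ) ≤ A.queries := Nat.cast_nonneg _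
  set e := δ ^ ⌈a ^ (1 / 16 : ℝ)⌉₊ with he
  have he0 : 0 ≤ e := by positivity
  have hle : ∀ β : ℝ, 1 / 16 ≤ β → δ ^ ⌈a ^ β⌉₊ ≤ e := fun β hβ =>
    pow_le_pow_of_le_one hδ.le hδ1.le
      (Nat.ceil_mono (Real.rpow_le_rpow_of_exponent_le ha1.le hβ))
  have hquarter : ∀ β : ℝ, a ^ β / 4 ≤ (⌈a ^ β⌉₊ : ℝ) := fun β => by
    have h1 := Real.rpow_pos_of_pos ha0 β
    have h2 := Nat.le_ceil (a ^ β)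
    linarith
  have hpos : ∀ β : ℝ, 1 ≤ ⌈a ^ β / 4⌉₊ := fun β =>
    Nat.one_le_ceil_iff.2 (by positivity)
  -- Level 2 has two thresholds: `t₂` is a fixed power of N, so that its error survives later
  -- multiplication by `q`, while `s₂`, about j/4, is used only at the end.
  have main := A.successProb_le_of_thresholds (j := j) (t₁ := ⌈a ^ (6 / 7 * θ + 1 / 7)⌉₊)
    (t₂ := ⌈a ^ (1 / 8 : ℝ)⌉₊) (t₃ := ⌈a ^ (1 / 16 : ℝ)⌉₊) (s₂ := ⌈a ^ θ / 4⌉₊)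
    (s₄ := ⌈a ^ (θ / 3) / 4⌉₊) hδ.le hδ1.le (hle _ (by linarith)) (hle _ (by norm_num)) le_rfl
    (hpos _) (hpos _)
    (by
      rw [hN]
      refine nine_mul_sqrt_le ha1.le hδ.le hq' (β := 4 / 7 * θ + 3 / 7)
        (hq'.trans ?_) (hquarter _) (by linarith)
      gcongr
      linarith)
    (by
      rw [hN]
      exact nine_mul_sqrt_le ha1.le hδ.le hq' (ceil_le_two_mul_rpow ha1.le (by linarith))
        (hquarter _) (by linarith))
    (by
      rw [hN]
      exact nine_mul_sqrt_le ha1.le hδ.le hq' (ceil_le_two_mul_rpow ha1.le (by linarith))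
        (Nat.le_ceil _) (by linarith))
    (by
      rw [hN]
      exact nine_mul_sqrt_le ha1.le hδ.le hq' (ceil_le_two_mul_rpow ha1.le (by norm_num))
        (hquarter _) (by linarith))
    (by
      rw [hN]
      exact nine_mul_sqrt_le ha1.le hδ.le hq' (ceil_le_two_mul_rpow ha1.le (by norm_num))
        (Nat.le_ceil _) (by linarith))
    -- The divisors 4 leave room: 2 · j/4 + 10 · j/64 < j.
    (by
      intro m n hm hn
      rw [Nat.lt_ceil] at hm hn
      have hn3 : (n : ℝ) ^ 3 ≤ (a ^ (θ / 3) / 4) ^ 3 := by gcongr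
      rw [div_pow, ← Real.rpow_natCast (a ^ (θ / 3)) 3, ← Real.rpow_mul ha0.le] at hn3
      have : θ / 3 * (3 : ℕ) = θ := by push_cast; ring
      rw [this, hθ] at hn3
      rw [hθ] at hm
      have : (2 * m + 10 * n ^ 3 : ℝ) < j := by linarith
      exact_mod_cast this)
  refine main.trans ?_
  rw [hN]
  have hj2 : 36 * (j : ℝ) ^ 2 / a ≤ δ ^ 2 := by
    refine le_trans ?_ hN₂
    rw [mul_div_assoc]
    gcongr
    rw [← hθ, ← Real.rpow_natCast, ← Real.rpow_mul ha0.le]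
    nth_rw 2 [← Real.rpow_one a]
    rw [← Real.rpow_sub ha0]
    exact Real.rpow_le_rpow_of_exponent_le ha1.le (by push_cast; linarith)
  have hae : a * e ≤ a ^ 3 * e := by
    gcongr
    exact le_self_pow₀ ha1.le (by norm_num)
  have ha2e : a ^ 2 * e ≤ a ^ 3 * e := by
    gcongr
    · exact ha1.le
    · norm_num
  have e1 : (A.queries : ℝ) * (e + A.queries * (e + A.queries * e)) ≤ δ := by
    calc (A.queries : ℝ) * (e + A.queries * (e + A.queries * e))
        ≤ a * (e + a * (e + a * e)) := by gcongr
      _ = a * e + a ^ 2 * e + a ^ 3 * e := by ring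
      _ ≤ 3 * a ^ 3 * e := by linarith
      _ ≤ δ := hN₁
  have e2 : (A.queries : ℝ) * e ≤ δ := by
    refine le_trans ?_ e1
    gcongr
    have : 0 ≤ (A.queries : ℝ) * (e + A.queries * e) := by positivity
    linarith
  have k1 : (δ + A.queries * e) ^ 2 ≤ (δ + δ) ^ 2 := by gcongr
  have k2 : (δ + A.queries * (e + A.queries * (e + A.queries * e))) ^ 2 ≤ (δ + δ) ^ 2 := by
    gcongr
  -- The total is 2(4δ² + 4δ²) + δ² = 17δ².
  nlinarith

end Bound

end QuantumQuery

/-! ### Choice of constants. -/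

theorem mainTheorem5 :
    ∀ p : ℝ, 0 < p → ∃ c : ℝ, 0 < c ∧ ∃ N₀ : ℕ,
      ∀ (X Y Z : Type*) [Fintype X] [DecidableEq X] [Fintype Y] [AddCommGroup Y] [Fintype Z]
        (A : QuantumQuery.Algorithm X Y Z) (N j : ℕ),
        Fintype.card Y = N → N₀ ≤ N →
        (j : ℝ) ≤ (N : ℝ) ^ (1 / 8 : ℝ) →
        p ≤ QuantumQuery.successProb A 3 j →
        c * (j : ℝ) ^ (4 / 7 : ℝ) * (N : ℝ) ^ (3 / 7 : ℝ) ≤ (A.queries : ℝ) := by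
  intro p hp
  -- This makes 17δ² ≤ (17/2)δ ≤ p/2 < p.
  set δ : ℝ := min (1 / 2) (p / 17) with hδ_def
  have hδ : 0 < δ := lt_min (by norm_num) (by positivity)
  have hδ2 : δ ≤ 1 / 2 := min_le_left _ _
  have hδp : δ ≤ p / 17 := min_le_right _ _
  obtain ⟨N₁, hN₁⟩ := Filter.eventually_atTop.1
    ((QuantumQuery.eventually_pow_mul_pow_ceil_le hδ (by linarith)).and
      (QuantumQuery.eventually_rpow_le hδ))
  refine ⟨δ / 100, by positivity, max N₁ 2, ?_⟩
  intro X Y Z _ _ _ _ _ A N j hN hN₀ hj hsucc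
  -- For j = 0 the claimed bound is 0, and j is not a power of N.
  rcases Nat.eq_zero_or_pos j with rfl | hj1
  · rw [Nat.cast_zero, Real.zero_rpow (by norm_num), mul_zero, zero_mul]
    exact Nat.cast_nonneg _
  by_contra! hq
  obtain ⟨h₁, h₂⟩ := hN₁ N ((le_max_left _ _).trans hN₀)
  have h := QuantumQuery.successProb_le_of_queries_lt A hδ (by linarith) hN
    ((le_max_right _ _).trans hN₀) hj1 hj h₁ h₂ hq
  nlinarith
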